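/- All graphs are finite and simple. The maximum average degree $\mathrm{mad}(G)$ of a graph $G$ is the maximum, over all subgraphs $H$ of $G$, of the average degree of $H$ (with $\mathrm{mad}(G)=0$ if $G$ has no vertices). A colouring of $G$ (a function assigning a colour to each vertex, not necessarily proper) has clustering $c$ if every monochromatic component, that is, every connected component of the spanning subgraph of $G$ formed by the edges whose endpoints have the same colour, has at most $c$ vertices. $G$ is $k$-choosable with clustering $c$ if, for every assignment $L$ of a set $L(v)$ of at least $k$ colours to each vertex $v$ of $G$, there is a colouring $\phi$ of $G$ with clustering $c$ such that $\phi(v)\in L(v)$ for every vertex $v$. The clustered chromatic number of a class $\mathcal{G}$ of graphs is the minimum integer $k$ such that, for some integer $c$, every graph in $\mathcal{G}$ has a colouring with at most $k$ colours and clustering $c$. Theorem. Every graph $G$ is $\lfloor\frac23\mathrm{mad}(G)+1\rfloor$-choosable with clustering $57\lfloor\frac23\mathrm{mad}(G)\rfloor+6$. Consequently, for every real number $m\geq 0$, the clustered chromatic number of the class of graphs with maximum average degree at most $m$ is at most $\lfloor\frac{2m}{3}\rfloor+1$. -/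

import Mathlib

universe u v w

namespace ClusteredColouring

/-- The average degree of a finite graph, i.e. the mean of its vertex degrees
(by division by zero, it is `0` for the graph without vertices). -/
noncomputable def averageDegree {V : Type u} [Fintype V] (G : SimpleGraph V) : ℝ :=
  open Classical in (∑ v : V, (G.degree v : ℝ)) / (Fintype.card V : ℝ)

/-- The maximum average degree of a finite graph: the supremum of the average degrees of
its subgraphs. It is a maximum, see `isGreatest_mad`. The subgraph without vertices is
allowed, and contributes `0`, just as every one-vertex subgraph does. -/
noncomputable def mad {V : Type u} [Fintype V] (G : SimpleGraph V) : ℝ :=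
  open Classical in ⨆ H : G.Subgraph, averageDegree H.coe

open Classical in
/-- The supremum in the definition of `mad` is attained. -/
theorem isGreatest_mad {V : Type u} [Fintype V] (G : SimpleGraph V) :
    IsGreatest (Set.range fun H : G.Subgraph => averageDegree H.coe) (mad G) := by
  have hfin : (Set.range fun H : G.Subgraph => averageDegree H.coe).Finite :=
    Set.finite_range _
  have hne : (Set.range fun H : G.Subgraph => averageDegree H.coe).Nonempty :=
    Set.range_nonempty _
  exact ⟨hne.csSup_mem hfin, fun x hx => le_csSup hfin.bddAbove hx⟩

/-- The monochromatic subgraph of `G` under the colouring `φ`: the spanning subgraph formed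
by the edges whose endpoints have the same colour. -/
def monochromaticSubgraph {V : Type u} {C : Type v} (G : SimpleGraph V) (φ : V → C) :
    SimpleGraph V where
  Adj x y := G.Adj x y ∧ φ x = φ y
  symm := ⟨fun _ _ h => ⟨h.1.symm, h.2.symm⟩⟩
  loopless := ⟨fun _ h => h.1.ne rfl⟩

/-- A colouring `φ` of `G` has clustering `c` if each monochromatic component (connected
component of the monochromatic subgraph) has at most `c` vertices. -/
def HasClustering {V : Type u} {C : Type v} (G : SimpleGraph V) (φ : V → C) (c : ℕ) : Prop :=
  ∀ K : (monochromaticSubgraph G φ).ConnectedComponent, K.supp.encard ≤ (c : ℕ∞)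

/-- `L` is a `k`-list-assignment if each list `L v` contains at least `k` colours. -/
def IsListAssignment {V : Type u} {C : Type v} (k : ℕ) (L : V → Set C) : Prop :=
  ∀ x : V, (k : ℕ∞) ≤ (L x).encard

/-- `G` is `k`-choosable with clustering `c`: for every `k`-list-assignment `L` of `G`
(with any type of colours) there is an `L`-colouring of `G` with clustering `c`. -/
def ChoosableWithClustering {V : Type u} (G : SimpleGraph V) (k c : ℕ) : Prop :=
  ∀ (C : Type w) (L : V → Set C), IsListAssignment k L →
    ∃ φ : V → C, (∀ x, φ x ∈ L x) ∧ HasClustering G φ c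

/-- `G` is `k`-colourable with clustering `c`. -/
def ColourableWithClustering {V : Type u} (G : SimpleGraph V) (k c : ℕ) : Prop :=
  ∃ φ : V → Fin k, HasClustering G φ c

/-- The clustered chromatic number of a class `𝒢` of finite graphs: the minimum `k` such that,
for some `c`, every graph in `𝒢` is `k`-colourable with clustering `c` (and `⊤` if there is
no such `k`). -/
noncomputable def clusteredChromaticNumber
    (𝒢 : (V : Type u) → [Fintype V] → SimpleGraph V → Prop) : ℕ∞ :=
  sInf {k : ℕ∞ | ∃ n : ℕ, k = n ∧ ∃ c : ℕ, ∀ (V : Type u) [Fintype V] (G : SimpleGraph V),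
    𝒢 V G → ColourableWithClustering G n c}

end ClusteredColouring

/-! Put k = ⌊2 mad(G)/3⌋ + 1, so that 4 e(G[U]) < 3k|U| for every nonempty U. Induction on the
number of vertices reduces the problem to a sparse one (`IsSparse`). Take a largest set B with ∑_{v
∈ B} (deg v + deg_B v) ≥ 3k|B|. It is a proper subset, so G[B] is coloured by induction, and every
outside vertex loses the colours of its neighbours in B. No monochromatic edge then leaves B, and
maximality of B makes G - B with the remaining lists sparse.

In the sparse case, start from a list colouring with the fewest monochromatic edges. Each vertex v
sees every colour of its list at least as often as its own, and deg v < 3|L(v)|, so monochromatic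
degrees are at most 2 and the components are paths and cycles. Long ones are broken by recolouring
vertices of monochromatic degree 2 with a colour they see exactly twice (`IsOption`). Independent
recolourings of this kind with one colour preserve minimality (`IsMinColouring.recolour`). Hence an
option attaches to a component only at a vertex of monochromatic degree at most 1, and few options
compete for a component: the conflict graph has maximum degree at most 7k - 5 (`card_conflicts_le`).

By sparsity a segment of 14k - 9 consecutive vertices carries at least 2(7k - 5) options
(`card_le_card_options`). Haxell's theorem (`exists_isIndepTransversal`) therefore picks one option
per segment without conflicts. Recolouring these leaves short pieces (`exists_cutting_segments`),
and each recoloured vertex joins at most two of them. For k = 1 no recolouring is needed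
(`hasClustering_six`). -/

namespace ClusteredColouring

open Finset
open scoped Classical

/-! ### Independent transversals: Haxell's theorem. -/

/-- `f` picks from every class `π ⁻¹' {i} ∩ U` with `i ∈ I` one vertex, and the vertices
picked are pairwise non-adjacent. -/
def IsIndepTransversal {X : Type*} {ι : Type*} (F : SimpleGraph X) (U : Finset X) (π : X → ι)
    (I : Finset ι) (f : ι → X) : Prop :=
  (∀ i ∈ I, f i ∈ U ∧ π (f i) = i) ∧ ∀ i ∈ I, ∀ j ∈ I, ¬ F.Adj (f i) (f j)

theorem IsIndepTransversal.anti {X : Type*} {ι : Type*} {F F' : SimpleGraph X} {U : Finset X}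
    {π : X → ι} {I : Finset ι} {f : ι → X} (h : IsIndepTransversal F U π I f) (hF : F' ≤ F) :
    IsIndepTransversal F' U π I f :=
  ⟨h.1, fun i hi j hj hadj => h.2 i hi j hj (hF hadj)⟩

/-- If the classes in `I` have an independent transversal but those in `insert i₀ I` do not,
then some of the classes, that of `i₀` among them, are dominated by few vertices. -/
theorem exists_dominating {X : Type*} {ι : Type*} [Finite X] (r : ℕ) :
    ∀ (F : SimpleGraph X) (U : Finset X) (π : X → ι) (I : Finset ι) (i₀ : ι),
      #I = r → i₀ ∉ I → (∃ f, IsIndepTransversal F U π I f) →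
      (¬ ∃ f, IsIndepTransversal F U π (insert i₀ I) f) →
      ∃ S ⊆ insert i₀ I, i₀ ∈ S ∧ ∃ Z : Finset X, #Z + 2 ≤ 2 * #S ∧
        ∀ u ∈ U, π u ∈ S → ∃ z ∈ Z, F.Adj z u := by
  induction r with
  | zero =>
    intro F U π I i₀ hr hi₀ hf hno
    obtain rfl : I = ∅ := by simpa using hr
    refine ⟨{i₀}, by simp, by simp, ∅, by simp, fun u hu hπ => ?_⟩
    exact absurd ⟨fun _ => u, by simpa [IsIndepTransversal] using ⟨hu, by simpa using hπ⟩⟩ hno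
  | succ r ih =>
    intro F U π I i₀ hr hi₀ ⟨f, hf⟩ hno
    obtain ⟨F', hF', hmin⟩ := exists_minimal_le_of_wellFoundedLT
      (fun F' : SimpleGraph X => ¬ ∃ f, IsIndepTransversal F' U π (insert i₀ I) f) F hno
    by_cases hw : ∃ w ∈ U, π w = i₀
    swap
    · refine ⟨{i₀}, by simp, by simp, ∅, by simp, fun u hu hπ => ?_⟩
      exact absurd ⟨u, hu, by simpa using hπ⟩ hw
    obtain ⟨w, hwU, hw⟩ := hw
    have hf' := hf.anti hF'
    obtain ⟨i₁, hi₁, hadj⟩ : ∃ j ∈ I, F'.Adj w (f j) := by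
      by_contra! hcon
      have hne : ∀ i ∈ I, i ≠ i₀ := fun i hi h => hi₀ (h ▸ hi)
      refine hmin.prop ⟨Function.update f i₀ w, ?_, ?_⟩
      · intro i hi
        rcases mem_insert.1 hi with rfl | hi
        · simp [hwU, hw]
        · simpa [hne i hi] using hf.1 i hi
      · intro i hi j hj
        rcases mem_insert.1 hi with hi' | hi' <;> rcases mem_insert.1 hj with hj' | hj'
        · simp [hi', hj']
        · simpa [hi', hne j hj'] using hcon j hj'
        · simpa [hj', hne i hi', F'.adj_comm] using hcon i hi'
        · simpa [hne i hi', hne j hj'] using hf'.2 i hi' j hj'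
    have hne₁ : i₁ ≠ i₀ := fun h => hi₀ (h ▸ hi₁)
    obtain ⟨htU, htπ⟩ := hf.1 i₁ hi₁
    set t := f i₁ with ht
    -- By edge-minimality, deleting the edge between `w` and `t` creates a transversal. It must use
    -- both ends, and this is the only edge of `F'` among the vertices it picks.
    obtain ⟨g, hg⟩ : ∃ g, IsIndepTransversal (F'.deleteEdges {s(w, t)}) U π (insert i₀ I) g := by
      by_contra hcon
      have h1 := hmin.le_of_le hcon (F'.deleteEdges_le _)
      have h2 := h1 hadj
      simp [SimpleGraph.deleteEdges_adj] at h2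
    have hgne : ∀ i ∈ insert i₀ I, ∀ j ∈ insert i₀ I, F'.Adj (g i) (g j) →
        s(g i, g j) = s(w, t) := by
      intro i hi j hj h
      by_contra hcon
      exact hg.2 i hi j hj (by simp [SimpleGraph.deleteEdges_adj, h, hcon])
    obtain ⟨hg₀, hg₁⟩ : g i₀ = w ∧ g i₁ = t := by
      have h1 : ∃ i ∈ insert i₀ I, ∃ j ∈ insert i₀ I, F'.Adj (g i) (g j) := by
        by_contra! hcon
        exact hmin.prop ⟨g, hg.1, hcon⟩
      obtain ⟨i, hi, j, hj, hij⟩ := h1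
      have h2 := hgne i hi j hj hij
      have hi' := (hg.1 i hi).2
      have hj' := (hg.1 j hj).2
      rcases Sym2.eq_iff.1 h2 with ⟨h3, h4⟩ | ⟨h3, h4⟩
      · rw [h3, hw] at hi'
        rw [h4, htπ] at hj'
        subst hi' hj'
        exact ⟨h3, h4⟩
      · rw [h3, htπ] at hi'
        rw [h4, hw] at hj'
        subst hi' hj'
        exact ⟨h4, h3⟩
    have hi₁' : i₁ ∈ insert i₀ I := mem_insert_of_mem hi₁
    have hi₀' : i₀ ∈ insert i₀ I := mem_insert_self _ _
    -- Discard the neighbours of `w` and `t` and merge class `i₁` into class `i₀`. This leaves one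
    -- class fewer, at the price of the two vertices `w` and `t` in the dominating set.
    set U' := U.filter fun u => ¬ F'.Adj w u ∧ ¬ F'.Adj t u with hU'
    set π' : X → ι := fun u => if π u = i₁ then i₀ else π u with hπ'
    have hT : IsIndepTransversal F' U' π' (I.erase i₁) g := by
      constructor
      · intro i hi
        obtain ⟨hi1, hi2⟩ := mem_erase.1 hi
        have hi3 : i ∈ insert i₀ I := mem_insert_of_mem hi2
        obtain ⟨h1, h2⟩ := hg.1 i hi3
        have hii : i ≠ i₀ := fun h => hi₀ (h ▸ hi2)
        refine ⟨mem_filter.2 ⟨h1, fun h => ?_, fun h => ?_⟩, by simp [hπ', h2, hi1]⟩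
        · have h3 := hgne i₀ hi₀' i hi3 (by rwa [hg₀])
          rw [hg₀] at h3
          have h4 : g i = t := by
            rcases Sym2.eq_iff.1 h3 with h | h
            · exact h.2
            · exact absurd h.1 hadj.ne
          rw [h4, htπ] at h2
          exact hi1 h2.symm
        · have h3 := hgne i₁ hi₁' i hi3 (by rwa [hg₁])
          rw [hg₁] at h3
          have h4 : g i = w := by
            rcases Sym2.eq_iff.1 h3 with h | h
            · exact absurd h.1 hadj.ne'
            · exact h.2
          rw [h4, hw] at h2
          exact hii h2.symm
      · intro i hi j hj h
        obtain ⟨hi1, hi2⟩ := mem_erase.1 hi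
        obtain ⟨hj1, hj2⟩ := mem_erase.1 hj
        have h3 := hgne i (mem_insert_of_mem hi2) j (mem_insert_of_mem hj2) h
        have h4 := (hg.1 i (mem_insert_of_mem hi2)).2
        have h5 := (hg.1 j (mem_insert_of_mem hj2)).2
        rcases Sym2.eq_iff.1 h3 with h | h
        · rw [h.2, htπ] at h5
          exact hj1 h5.symm
        · rw [h.1, htπ] at h4
          exact hi1 h4.symm
    -- The vertex picked from the merged class comes from class `i₁` or class `i₀`. Adding `w` or
    -- `t` respectively, neither of which has a neighbour in `U'`, would complete a transversal of
    -- `F'`.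
    have hno' : ¬ ∃ f, IsIndepTransversal F' U' π' (insert i₀ (I.erase i₁)) f := by
      rintro ⟨h, hh⟩
      have key : ∀ i ∈ insert i₀ I, i ≠ i₀ → i ≠ i₁ → i ∈ insert i₀ (I.erase i₁) ∧
          h i ∈ U ∧ π (h i) = i := by
        intro i hi hi0 hi1
        have hi' : i ∈ insert i₀ (I.erase i₁) := by
          simp only [mem_insert, mem_erase] at hi ⊢
          tauto
        obtain ⟨h1, h2⟩ := hh.1 i hi'
        refine ⟨hi', (mem_filter.1 h1).1, ?_⟩
        by_cases h3 : π (h i) = i₁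
        · simp only [hπ', h3, if_true] at h2
          exact absurd h2.symm hi0
        · simpa [hπ', h3] using h2
      have hmem₀ : i₀ ∈ insert i₀ (I.erase i₁) := mem_insert_self _ _
      obtain ⟨h1, h2⟩ := hh.1 i₀ hmem₀
      obtain ⟨h1U, h1w, h1t⟩ := mem_filter.1 h1
      have hnadj : ∀ i ∈ insert i₀ (I.erase i₁), ¬ F'.Adj w (h i) ∧ ¬ F'.Adj t (h i) :=
        fun i hi => (mem_filter.1 (hh.1 i hi).1).2
      by_cases h3 : π (h i₀) = i₁
      · refine hmin.prop ⟨fun i => if i = i₀ then w else if i = i₁ then h i₀ else h i, ?_, ?_⟩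
        · intro i hi
          by_cases hi0 : i = i₀
          · simp [hi0, hwU, hw]
          by_cases hi1 : i = i₁
          · simp [hi1, hne₁, h1U, h3]
          · simpa [hi0, hi1] using (key i hi hi0 hi1).2
        · have hX : ∀ i ∈ insert i₀ I, i ≠ i₀ → ∃ i' ∈ insert i₀ (I.erase i₁),
              (if i = i₁ then h i₀ else h i) = h i' := by
            intro i hi hi0
            by_cases hi1 : i = i₁
            · exact ⟨i₀, hmem₀, by simp [hi1]⟩
            · exact ⟨i, (key i hi hi0 hi1).1, by simp [hi1]⟩
          intro i hi j hj
          by_cases hi0 : i = i₀ <;> by_cases hj0 : j = i₀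
          · simp [hi0, hj0]
          · obtain ⟨j', hj', hje⟩ := hX j hj hj0
            simpa [hi0, hj0, hje] using (hnadj j' hj').1
          · obtain ⟨i', hi', hie⟩ := hX i hi hi0
            simpa [hi0, hj0, hie, F'.adj_comm] using (hnadj i' hi').1
          · obtain ⟨i', hi', hie⟩ := hX i hi hi0
            obtain ⟨j', hj', hje⟩ := hX j hj hj0
            simpa [hi0, hj0, hie, hje] using hh.2 i' hi' j' hj'
      · have h4 : π (h i₀) = i₀ := by simpa [hπ', h3] using h2
        have hX : ∀ i ∈ insert i₀ I, i ≠ i₁ → i ∈ insert i₀ (I.erase i₁) := by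
          intro i hi hi1
          simp only [mem_insert, mem_erase] at hi ⊢
          tauto
        refine hmin.prop ⟨fun i => if i = i₁ then t else h i, ?_, ?_⟩
        · intro i hi
          by_cases hi1 : i = i₁
          · simp [hi1, htU, htπ]
          by_cases hi0 : i = i₀
          · simp [hi0, hne₁.symm, h1U, h4]
          · simpa [hi0, hi1] using (key i hi hi0 hi1).2
        · intro i hi j hj
          by_cases hi1 : i = i₁ <;> by_cases hj1 : j = i₁
          · simp [hi1, hj1]
          · simpa [hi1, hj1] using (hnadj j (hX j hj hj1)).2
          · simpa [hi1, hj1, F'.adj_comm] using (hnadj i (hX i hi hi1)).2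
          · simpa [hi1, hj1] using hh.2 i (hX i hi hi1) j (hX j hj hj1)
    obtain ⟨S', hS', hiS', Z', hZ', hdom⟩ := ih F' U' π' (I.erase i₁) i₀
      (by rw [card_erase_of_mem hi₁, hr]; rfl) (by simp [hi₀]) ⟨g, hT⟩ hno'
    have hi₁S : i₁ ∉ S' := fun h => by
      have := hS' h
      simp [hne₁] at this
    refine ⟨insert i₁ S', ?_, by simp [hiS'], insert w (insert t Z'), ?_, ?_⟩
    · intro i hi
      rcases mem_insert.1 hi with rfl | hi
      · exact hi₁'
      · rcases mem_insert.1 (hS' hi) with rfl | h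
        · exact hi₀'
        · exact mem_insert_of_mem (mem_of_mem_erase h)
    · rw [card_insert_of_notMem hi₁S]
      have := card_insert_le w (insert t Z')
      have := card_insert_le t Z'
      omega
    · intro u hu hπu
      by_cases hwu : F'.Adj w u
      · exact ⟨w, by simp, hF' hwu⟩
      by_cases htu : F'.Adj t u
      · exact ⟨t, by simp, hF' htu⟩
      obtain ⟨z, hz, hzu⟩ := hdom u (by simp [hU', hu, hwu, htu]) (by
        rcases mem_insert.1 hπu with h | h
        · simpa [hπ', h] using hiS'
        · have : π u ≠ i₁ := fun h' => hi₁S (h' ▸ h)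
          simpa [hπ', this] using h)
      exact ⟨z, by simp [hz], hF' hzu⟩

/-- **Haxell's theorem**: classes of at least `2 * D` vertices in a graph of maximum degree at
most `D` have an independent transversal. -/
theorem exists_isIndepTransversal {X : Type*} {ι : Type*} [Fintype X] [Nonempty X]
    (F : SimpleGraph X)
    (U : Finset X) (π : X → ι) (D : ℕ) (hD : 0 < D)
    (hdeg : ∀ x, #{y | F.Adj x y} ≤ D) (I : Finset ι)
    (hI : ∀ i ∈ I, 2 * D ≤ #{x ∈ U | π x = i}) :
    ∃ f, IsIndepTransversal F U π I f := by
  obtain ⟨x₀⟩ := ‹Nonempty X›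
  induction I using Finset.induction_on with
  | empty => exact ⟨fun _ => x₀, by simp [IsIndepTransversal]⟩
  | insert i₀ I hi₀ ih =>
    by_contra hno
    obtain ⟨S, hS, hiS, Z, hZ, hdom⟩ := exists_dominating #I F U π I i₀ rfl hi₀
      (ih fun i hi => hI i (mem_insert_of_mem hi)) hno
    -- Double count: the classes in `S` contain at least 2D|S| vertices, but at most 2|S| - 2
    -- vertices dominate them, each at most D of them.
    have h1 : #S * (2 * D) ≤ #{x ∈ U | π x ∈ S} := by
      have h2 : ({x ∈ U | π x ∈ S} : Finset X) = S.biUnion fun i => {x ∈ U | π x = i} := by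
        ext x
        simp only [mem_filter, mem_biUnion]
        aesop
      rw [h2, card_biUnion]
      · rw [← smul_eq_mul]
        exact card_nsmul_le_sum _ _ _ fun i hi => hI i (hS hi)
      · intro i _ j _ hij
        refine disjoint_left.2 fun x hx hx' => hij ?_
        rw [← (mem_filter.1 hx).2, (mem_filter.1 hx').2]
    have h2 : #{x ∈ U | π x ∈ S} ≤ #Z * D := by
      refine (card_le_card (t := Z.biUnion fun z => {y | F.Adj z y}) ?_).trans
        (card_biUnion_le_card_mul _ _ _ fun z _ => hdeg z)
      intro x hx
      obtain ⟨hxU, hxS⟩ := mem_filter.1 hx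
      obtain ⟨z, hz, hzx⟩ := hdom x hxU hxS
      exact mem_biUnion.2 ⟨z, hz, by simpa using hzx⟩
    have h3 : (#Z + 2) * D ≤ 2 * #S * D := Nat.mul_le_mul_right _ hZ
    nlinarith

/-! ### Graphs of maximum degree two and how to cut them. -/

/-- A component of a finite graph of maximum degree at most two is a path or a cycle. -/
theorem exists_path_enumeration {V : Type*} [Fintype V] (M : SimpleGraph V)
    (hM : ∀ v, #{w | M.Adj v w} ≤ 2) (Q : M.ConnectedComponent) :
    ∃ (N : ℕ) (g : ℕ → V), (∀ i < N, M.connectedComponentMk (g i) = Q) ∧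
      (∀ i < N, ∀ j < N, g i = g j → i = j) ∧
      (∀ v, M.connectedComponentMk v = Q → ∃ i < N, g i = v) ∧
      (∀ i, i + 1 < N → M.Adj (g i) (g (i + 1))) ∧
      (∀ i j, i < j → j < N → M.Adj (g i) (g j) → j = i + 1 ∨ (i = 0 ∧ j + 1 = N)) := by
  set P : ℕ → (ℕ → V) → Prop := fun m g => M.connectedComponentMk (g 0) = Q ∧
    (∀ i ≤ m, ∀ j ≤ m, g i = g j → i = j) ∧ ∀ i < m, M.Adj (g i) (g (i + 1)) with hP
  have hcomp : ∀ m g, P m g → ∀ i ≤ m, M.connectedComponentMk (g i) = Q := by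
    intro m g hg i
    induction i with
    | zero => exact fun _ => hg.1
    | succ i ih =>
      intro hi
      rw [← ih (by omega)]
      exact (SimpleGraph.ConnectedComponent.sound (hg.2.2 i (by omega)).reachable).symm
  have hbound : ∀ m g, P m g → m ≤ Fintype.card V := by
    intro m g hg
    have h1 : #(range (m + 1)) ≤ #(univ : Finset V) :=
      card_le_card_of_injOn g (by simp) (fun i hi j hj h =>
        hg.2.1 i (by simp at hi; omega) j (by simp at hj; omega) h)
    rw [card_range, card_univ] at h1
    omega
  -- A longest path is closed under adjacency, hence the whole component: its ends by maximality
  -- (applied also to the reversed path), its interior vertices because the path already uses up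
  -- their degree.
  obtain ⟨m, g, hg, hmax⟩ : ∃ m g, P m g ∧ ∀ m' g', P m' g' → m' ≤ m := by
    obtain ⟨v, hv⟩ := Q.exists_rep
    have h0 : ∃ g, P 0 g := ⟨fun _ => v, hv, by intros; omega, by intros; omega⟩
    have h1 := Nat.findGreatest_spec (P := fun m => ∃ g, P m g) (Nat.zero_le (Fintype.card V)) h0
    obtain ⟨g, hg⟩ := h1
    exact ⟨_, g, hg, fun m' g' hg' => Nat.le_findGreatest (hbound m' g' hg') ⟨g', hg'⟩⟩
  have hright : ∀ g', P m g' → ∀ w, M.Adj (g' m) w → ∃ i ≤ m, g' i = w := by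
    intro g' hg' w hw
    by_contra! hcon
    have hlt : ∀ i ≤ m, (if i ≤ m then g' i else w) = g' i := fun i hi => if_pos hi
    have := hmax (m + 1) (fun i => if i ≤ m then g' i else w) ⟨by simpa using hg'.1, ?_, ?_⟩
    · omega
    · intro i hi j hj h
      by_cases hi' : i ≤ m <;> by_cases hj' : j ≤ m <;> simp only [hi', hj', if_true, if_false] at h
      · exact hg'.2.1 i hi' j hj' h
      · exact absurd h (hcon i hi')
      · exact absurd h.symm (hcon j hj')
      · omega
    · intro i hi
      by_cases hi' : i + 1 ≤ m
      · simpa [hi', show i ≤ m by omega] using hg'.2.2 i (by omega)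
      · obtain rfl : i = m := by omega
        simpa using hw
  have hrev : P m fun i => g (m - i) := by
    refine ⟨by simpa using hcomp m g hg m le_rfl, ?_, ?_⟩
    · intro i hi j hj h
      have := hg.2.1 (m - i) (by omega) (m - j) (by omega) h
      omega
    · intro i hi
      have := hg.2.2 (m - (i + 1)) (by omega)
      rw [show m - (i + 1) + 1 = m - i by omega] at this
      exact this.symm
  have hint : ∀ i, 0 < i → i < m → ∀ w, M.Adj (g i) w → w = g (i - 1) ∨ w = g (i + 1) := by
    intro i hi0 him w hw
    by_contra! hcon
    have h1 := hg.2.2 (i - 1) (by omega)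
    rw [show i - 1 + 1 = i by omega] at h1
    have h2 : #{w, g (i - 1), g (i + 1)} ≤ 2 :=
      (card_le_card (by
        intro x hx
        simp only [mem_insert, mem_singleton] at hx
        rcases hx with rfl | rfl | rfl
        · simpa using hw
        · simpa using h1.symm
        · simpa using hg.2.2 i him)).trans (hM (g i))
    rw [card_eq_three.2 ⟨w, g (i - 1), g (i + 1), hcon.1, hcon.2, fun h => by
      have := hg.2.1 (i - 1) (by omega) (i + 1) (by omega) h
      omega, rfl⟩] at h2
    omega
  have hclosed : ∀ i ≤ m, ∀ w, M.Adj (g i) w → ∃ j ≤ m, g j = w := by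
    intro i hi w hw
    rcases Nat.lt_or_ge i m with him | him
    · rcases Nat.eq_zero_or_pos i with rfl | hi0
      · obtain ⟨j, hj, hjw⟩ := hright (fun i => g (m - i)) hrev w (by simpa using hw)
        exact ⟨m - j, by omega, hjw⟩
      · rcases hint i hi0 him w hw with h | h
        · exact ⟨i - 1, by omega, h.symm⟩
        · exact ⟨i + 1, by omega, h.symm⟩
    · obtain rfl : i = m := by omega
      exact hright g hg w hw
  refine ⟨m + 1, g, fun i hi => hcomp m g hg i (by omega),
    fun i hi j hj => hg.2.1 i (by omega) j (by omega), ?_, fun i hi => hg.2.2 i (by omega), ?_⟩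
  · intro v hv
    rw [← hg.1, eq_comm, SimpleGraph.ConnectedComponent.eq,
      SimpleGraph.reachable_iff_reflTransGen] at hv
    have : ∃ j ≤ m, g j = v := by
      induction hv with
      | refl => exact ⟨0, by omega, rfl⟩
      | tail _ hab ih =>
        obtain ⟨j, hj, rfl⟩ := ih
        exact hclosed j hj _ hab
    obtain ⟨j, hj, hjv⟩ := this
    exact ⟨j, by omega, hjv⟩
  · intro i j hij hj hadj
    rcases Nat.eq_zero_or_pos i with rfl | hi0
    · rcases Nat.lt_or_ge j m with hjm | hjm
      · rcases hint j hij hjm _ hadj.symm with h | h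
        · have := hg.2.1 0 (by omega) (j - 1) (by omega) h
          omega
        · have := hg.2.1 0 (by omega) (j + 1) (by omega) h
          omega
      · omega
    · rcases hint i hi0 (by omega) _ hadj with h | h
      · have := hg.2.1 j (by omega) (i - 1) (by omega) h
        omega
      · have := hg.2.1 j (by omega) (i + 1) (by omega) h
        omega

/-- The graph `M` with all edges at vertices of `X` deleted. -/
def cutAt {V : Type*} (M : SimpleGraph V) (X : Set V) : SimpleGraph V where
  Adj x y := M.Adj x y ∧ x ∉ X ∧ y ∉ X
  symm := ⟨fun _ _ h => ⟨h.1.symm, h.2.2, h.2.1⟩⟩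
  loopless := ⟨fun _ h => h.1.ne rfl⟩

/-- The degree sum of a path on `n` vertices, the two summands counting predecessor and successor.
-/
theorem sum_range_interior (n : ℕ) :
    ∑ t ∈ range n, ((if 0 < t then 1 else 0) + (if t + 1 < n then 1 else 0)) = 2 * (n - 1) := by
  cases n with
  | zero => rfl
  | succ n =>
    rw [sum_add_distrib, sum_range_succ', sum_range_succ (fun t => if t + 1 < n + 1 then 1 else 0)]
    have : ∑ t ∈ range n, (if t + 1 < n + 1 then 1 else 0) = n := by
      rw [sum_congr rfl fun t ht => if_pos (by simpa using ht)]
      simp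
    rw [this]
    simp
    omega

/-- In a graph of maximum degree at most two, there are disjoint segments of `n` vertices such
that deleting at least one vertex of each of them leaves only short components, and even
shorter ones around vertices of degree at most one. -/
theorem exists_cutting_segments {V : Type*} [Fintype V] (M : SimpleGraph V)
    (hM : ∀ v, #{w | M.Adj v w} ≤ 2) (n : ℕ) (hn : 2 ≤ n) :
    ∃ (I : Finset (M.ConnectedComponent × ℕ)) (π : V → M.ConnectedComponent × ℕ) (U : Finset V),
      (∀ v ∈ U, #{w | M.Adj v w} = 2) ∧
      (∀ i ∈ I, #{v ∈ U | π v = i} = n ∧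
        2 * (n - 1) ≤ ∑ v ∈ U with π v = i, #{w ∈ {v ∈ U | π v = i} | M.Adj v w}) ∧
      ∀ X : Set V, (∀ i ∈ I, ∃ v ∈ X, v ∈ U ∧ π v = i) → ∀ u ∉ X,
        #{w | (cutAt M X).Reachable u w} ≤ 2 * (n + n / 2) ∧
        ∀ x, (cutAt M X).Reachable u x → #{w | M.Adj x w} ≤ 1 →
          #{w | (cutAt M X).Reachable u w} ≤ n + n / 2 := by
  choose N g hgQ hinj hsurj hadj hadj' using exists_path_enumeration M hM
  set q := M.connectedComponentMk with hq
  choose idx hidx hgidx using fun v => hsurj (q v) v rfl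
  have hidxg : ∀ Q, ∀ i < N Q, idx (g Q i) = i := by
    intro Q i hi
    have h1 := hidx (g Q i)
    have h2 := hgidx (g Q i)
    rw [hgQ Q i hi] at h1 h2
    exact hinj Q _ h1 _ hi h2
  have hqadj : ∀ v w, M.Adj v w → q v = q w := fun v w h =>
    SimpleGraph.ConnectedComponent.sound h.reachable
  have hidxadj : ∀ v w, M.Adj v w → idx w = idx v + 1 ∨ idx v = idx w + 1 ∨
      (idx v = 0 ∧ idx w + 1 = N (q v)) ∨ (idx w = 0 ∧ idx v + 1 = N (q v)) := by
    intro v w h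
    have hvw := hqadj v w h
    have h1 := hidx w
    have h2 := hgidx w
    rw [← hvw] at h1 h2
    have h3 : M.Adj (g (q v) (idx v)) (g (q v) (idx w)) := by rwa [hgidx, h2]
    rcases lt_trichotomy (idx v) (idx w) with h4 | h4 | h4
    · have := hadj' _ _ _ h4 h1 h3
      omega
    · rw [h4] at h3
      exact absurd h3 (SimpleGraph.irrefl _)
    · have := hadj' _ _ _ h4 (hidx v) h3.symm
      omega
  have hnext : ∀ v w, q v = q w → idx w = idx v + 1 → M.Adj v w := by
    intro v w hvw h
    have h1 := hadj (q v) (idx v) (by rw [← h, hvw]; exact hidx w)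
    rwa [hgidx, ← h, hvw, hgidx] at h1
  have hdeg : ∀ v, 0 < idx v → idx v + 1 < N (q v) → #{w | M.Adj v w} = 2 := by
    intro v h0 h1
    refine le_antisymm (hM v) ?_
    have h2 := hgQ (q v) (idx v - 1) (by omega)
    have h3 := hidxg (q v) (idx v - 1) (by omega)
    have h4 := hgQ (q v) (idx v + 1) (by omega)
    have h5 := hidxg (q v) (idx v + 1) (by omega)
    rw [← card_pair (a := g (q v) (idx v - 1)) (b := g (q v) (idx v + 1))]
    · refine card_le_card fun x hx => ?_
      simp only [mem_insert, mem_singleton] at hx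
      rcases hx with rfl | rfl
      · simpa using (hnext _ v h2 (by omega)).symm
      · simpa using hnext v _ h4.symm h5
    · intro h
      rw [h] at h3
      omega
  have hcount : ∀ (Q) (R : Finset V) (J : Finset ℕ), (∀ w ∈ R, q w = Q ∧ idx w ∈ J) →
      #R ≤ #J := by
    intro Q R J h
    refine card_le_card_of_injOn idx (fun w hw => (h w hw).2) fun w hw w' hw' hww => ?_
    rw [← hgidx w, ← hgidx w', (h w hw).1, (h w' hw').1, hww]
  -- The first and last vertex stay outside the segments, so that segment vertices have degree two.
  -- The remainder modulo `n` is shared evenly between both ends, whence the term `n / 2` in the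
  -- bounds.
  set m : M.ConnectedComponent → ℕ := fun Q => (N Q - 2) / n with hm
  set o : M.ConnectedComponent → ℕ := fun Q => 1 + ((N Q - 2) % n) / 2 with ho
  have hNm : ∀ Q, N Q - 2 = m Q * n + (N Q - 2) % n := fun Q => by
    rw [hm, mul_comm]; exact (Nat.div_add_mod _ _).symm
  have hmod : ∀ Q, (N Q - 2) % n < n := fun Q => Nat.mod_lt _ (by omega)
  set U : Finset V := {v | o (q v) ≤ idx v ∧ idx v < o (q v) + m (q v) * n} with hU
  set π : V → M.ConnectedComponent × ℕ := fun v => (q v, (idx v - o (q v)) / n) with hπ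
  set I : Finset (M.ConnectedComponent × ℕ) :=
    univ.biUnion fun Q => (range (m Q)).image fun j => (Q, j) with hI
  have hmemI : ∀ Q j, (Q, j) ∈ I ↔ j < m Q := by
    intro Q j
    simp [hI]
  have hmn : ∀ Q j, j < m Q → (j + 1) * n ≤ m Q * n := fun Q j h => Nat.mul_le_mul_right _ h
  have hmemclass : ∀ Q j, j < m Q → ∀ v, (v ∈ U ∧ π v = (Q, j)) ↔
      q v = Q ∧ o Q + j * n ≤ idx v ∧ idx v < o Q + (j + 1) * n := by
    intro Q j hj v
    have h1 := hmn Q j hj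
    have h0 : (j + 1) * n = j * n + n := Nat.succ_mul j n
    rw [h0] at h1 ⊢
    simp only [hU, mem_filter, mem_univ, true_and, hπ, Prod.mk.injEq]
    constructor
    · rintro ⟨⟨h2, h3⟩, rfl, h4⟩
      have h5 := Nat.div_add_mod (idx v - o (q v)) n
      have h6 := Nat.mod_lt (idx v - o (q v)) (show n > 0 by omega)
      rw [h4, mul_comm] at h5
      exact ⟨rfl, by omega, by omega⟩
    · rintro ⟨rfl, h2, h3⟩
      refine ⟨⟨by omega, by omega⟩, rfl, le_antisymm ?_ ?_⟩
      · rw [← Nat.lt_succ_iff, Nat.div_lt_iff_lt_mul (by omega), h0]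
        omega
      · rw [Nat.le_div_iff_mul_le (by omega)]
        omega
  refine ⟨I, π, U, ?_, ?_, ?_⟩
  · intro v hv
    simp only [hU, mem_filter, mem_univ, true_and] at hv
    have h1 := hNm (q v)
    have h3 : 0 < m (q v) * n := by omega
    simp only [ho] at hv
    exact hdeg v (by omega) (by omega)
  · rintro ⟨Q, j⟩ hj
    rw [hmemI] at hj
    have h0 := hmn Q j hj
    have h1 := hNm Q
    have hlt : ∀ t < n, o Q + j * n + t < N Q := by
      intro t ht
      rw [Nat.succ_mul] at h0
      simp only [ho]
      omega
    have hclass : ({v ∈ U | π v = (Q, j)} : Finset V) =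
        (range n).image fun t => g Q (o Q + j * n + t) := by
      ext v
      rw [mem_filter, hmemclass Q j hj, mem_image]
      constructor
      · rintro ⟨rfl, h2, h3⟩
        rw [Nat.succ_mul] at h3
        refine ⟨idx v - (o (q v) + j * n), by simp; omega, ?_⟩
        rw [Nat.add_sub_cancel' h2, hgidx]
      · rintro ⟨t, ht, rfl⟩
        rw [mem_range] at ht
        rw [hgQ Q _ (hlt t ht), hidxg Q _ (hlt t ht), Nat.succ_mul]
        exact ⟨rfl, by omega, by omega⟩
    have hinj' : Set.InjOn (fun t => g Q (o Q + j * n + t)) (range n) := by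
      intro t ht t' ht' h
      have := hinj Q _ (hlt t (by simpa using ht)) _ (hlt t' (by simpa using ht')) h
      omega
    rw [hclass]
    refine ⟨by rw [card_image_of_injOn hinj', card_range], ?_⟩
    rw [sum_image hinj', ← sum_range_interior]
    refine sum_le_sum fun t ht => ?_
    rw [mem_range] at ht
    have hprev : 0 < t → M.Adj (g Q (o Q + j * n + t)) (g Q (o Q + j * n + (t - 1))) := by
      intro h
      have := hadj Q (o Q + j * n + (t - 1)) (by have := hlt t ht; omega)
      rw [show o Q + j * n + (t - 1) + 1 = o Q + j * n + t by omega] at this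
      exact this.symm
    have hsucc : t + 1 < n → M.Adj (g Q (o Q + j * n + t)) (g Q (o Q + j * n + (t + 1))) :=
      fun h => hadj Q (o Q + j * n + t) (hlt _ h)
    have hmem : ∀ s, s < n → M.Adj (g Q (o Q + j * n + t)) (g Q (o Q + j * n + s)) →
        g Q (o Q + j * n + s) ∈ ({w ∈ (range n).image fun t => g Q (o Q + j * n + t) |
          M.Adj (g Q (o Q + j * n + t)) w} : Finset V) := by
      intro s hs h
      exact mem_filter.2 ⟨mem_image.2 ⟨s, by simpa using hs, rfl⟩, h⟩
    split_ifs with h2 h3 h3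
    · rw [one_add_one_eq_two,
        ← card_pair (a := g Q (o Q + j * n + (t - 1))) (b := g Q (o Q + j * n + (t + 1)))]
      · refine card_le_card fun x hx => ?_
        simp only [mem_insert, mem_singleton] at hx
        rcases hx with rfl | rfl
        · exact hmem _ (by omega) (hprev h2)
        · exact hmem _ h3 (hsucc h3)
      · intro h
        have := hinj Q _ (hlt (t - 1) (by omega)) _ (hlt (t + 1) h3) h
        omega
    · exact card_pos.2 ⟨_, hmem _ (by omega) (hprev h2)⟩
    · exact card_pos.2 ⟨_, hmem _ h3 (hsucc h3)⟩
    · exact Nat.zero_le _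
  · intro X hX u hu
    set Q := q u with hQ
    -- `c j` is the index of a deleted vertex in segment `j`; the value 0 beyond the last segment is
    -- a dummy.
    have hc : ∀ j, ∃ c, j < m Q → o Q + j * n ≤ c ∧ c < o Q + (j + 1) * n ∧
        ∀ w, q w = Q → w ∉ X → idx w ≠ c := by
      intro j
      by_cases hj : j < m Q
      · obtain ⟨v, hvX, hvU, hvπ⟩ := hX (Q, j) ((hmemI Q j).2 hj)
        obtain ⟨h1, h2, h3⟩ := (hmemclass Q j hj v).1 ⟨hvU, hvπ⟩
        refine ⟨idx v, fun _ => ⟨h2, h3, fun w hw hwX h => hwX ?_⟩⟩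
        rwa [← hgidx w, hw, h, ← h1, hgidx]
      · exact ⟨0, fun h => absurd h hj⟩
    choose c hc1 hc2 hc3 using hc
    have hreach : ∀ w, (cutAt M X).Reachable u w → q w = Q ∧ w ∉ X := by
      intro w hw
      rw [SimpleGraph.reachable_iff_reflTransGen] at hw
      induction hw with
      | refl => exact ⟨rfl, hu⟩
      | tail _ hab ih => exact ⟨(hqadj _ _ hab.1).symm.trans ih.1, hab.2.2⟩
    set low : V → Prop := fun w => ∀ j < m Q, idx w < c j with hlow
    set high : V → Prop := fun w => ∀ j < m Q, c j < idx w with hhigh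
    have hlow0 : ∀ w, idx w = 0 → low w := by
      intro w hw j hj
      have := hc1 j hj
      simp only [ho] at this
      omega
    have hhighN : ∀ w, q w = Q → idx w + 1 = N Q → high w := by
      intro w hwQ hw j hj
      have h1 := hc2 j hj
      have h2 := hmn Q j hj
      have h3 := hNm Q
      simp only [ho] at h1
      have : 0 < (j + 1) * n := Nat.mul_pos (by omega) (by omega)
      omega
    -- An edge either stays on one side of every cut or is the closing edge of a cycle, joining the
    -- piece before the first cut to the piece after the last. Only this wrap-around doubles the
    -- bound.
    have hstep : ∀ a b, (cutAt M X).Adj a b → q a = Q →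
        (∀ j < m Q, c j < idx a ↔ c j < idx b) ∨ (low a ∧ high b) ∨ (low b ∧ high a) := by
      intro a b hab ha
      have hb : q b = Q := (hqadj _ _ hab.1).symm.trans ha
      rcases hidxadj a b hab.1 with h | h | ⟨h1, h2⟩ | ⟨h1, h2⟩
      · refine Or.inl fun j hj => ?_
        have := hc3 j hj a ha hab.2.1
        omega
      · refine Or.inl fun j hj => ?_
        have := hc3 j hj b hb hab.2.2
        omega
      · exact Or.inr (Or.inl ⟨hlow0 a h1, hhighN b hb (by rw [← ha]; exact h2)⟩)
      · exact Or.inr (Or.inr ⟨hlow0 b h1, hhighN a ha (by rw [← ha]; exact h2)⟩)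
    have hlowhigh : ∀ a b, q a = Q → a ∉ X → q b = Q → b ∉ X →
        (∀ j < m Q, c j < idx a ↔ c j < idx b) → (low a → low b) ∧ (high a → high b) := by
      intro a b _ _ hb hbX h
      refine ⟨fun ha j hj => ?_, fun ha j hj => (h j hj).1 (ha j hj)⟩
      have h1 := ha j hj
      have h2 := hc3 j hj b hb hbX
      have h3 := h j hj
      omega
    have hcardlow : ∀ R : Finset V, (∀ w ∈ R, q w = Q ∧ low w) → #R ≤ n + n / 2 := by
      intro R hR
      have h1 := hNm Q
      have h2 := hmod Q
      rcases Nat.eq_zero_or_pos (m Q) with h0 | h0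
      · refine (hcount Q R (range (N Q)) fun w hw => ⟨(hR w hw).1, ?_⟩).trans ?_
        · rw [mem_range, ← (hR w hw).1]
          exact hidx w
        · rw [h0, zero_mul] at h1
          rw [card_range]
          omega
      · refine (hcount Q R (range (c 0)) fun w hw =>
          ⟨(hR w hw).1, mem_range.2 ((hR w hw).2 0 h0)⟩).trans ?_
        have := hc2 0 h0
        simp only [ho] at this
        rw [card_range]
        omega
    have hcardhigh : ∀ R : Finset V, (∀ w ∈ R, q w = Q ∧ high w) → #R ≤ n + n / 2 := by
      intro R hR
      have h1 := hNm Q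
      have h2 := hmod Q
      rcases Nat.eq_zero_or_pos (m Q) with h0 | h0
      · exact hcardlow R fun w hw => ⟨(hR w hw).1, fun j hj => by omega⟩
      · have hlast : m Q - 1 < m Q := by omega
        refine (hcount Q R (Ioo (c (m Q - 1)) (N Q)) fun w hw =>
          ⟨(hR w hw).1, mem_Ioo.2 ⟨(hR w hw).2 _ hlast, ?_⟩⟩).trans ?_
        · rw [← (hR w hw).1]
          exact hidx w
        · have h3 := hc1 _ hlast
          have h4 : m Q * n = (m Q - 1) * n + n := by
            rw [← Nat.succ_mul]
            congr 1
            omega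
          simp only [ho] at h3
          rw [Nat.card_Ioo]
          omega
    have hsame : ¬ low u → ¬ high u → ∀ w, (cutAt M X).Reachable u w →
        ∀ j < m Q, c j < idx u ↔ c j < idx w := by
      intro hl hh w hw
      rw [SimpleGraph.reachable_iff_reflTransGen] at hw
      induction hw with
      | refl => exact fun _ _ => Iff.rfl
      | tail hua hab ih =>
        rename_i a b
        obtain ⟨haQ, haX⟩ := hreach a ((SimpleGraph.reachable_iff_reflTransGen _ _).2 hua)
        have h1 := hlowhigh a u haQ haX rfl hu fun j hj => (ih j hj).symm
        rcases hstep a b hab haQ with h | h | h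
        · exact fun j hj => (ih j hj).trans (h j hj)
        · exact absurd (h1.1 h.1) hl
        · exact absurd (h1.2 h.2) hh
    have hends : low u ∨ high u → ∀ w, (cutAt M X).Reachable u w → low w ∨ high w := by
      intro h0 w hw
      rw [SimpleGraph.reachable_iff_reflTransGen] at hw
      induction hw with
      | refl => exact h0
      | tail hua hab ih =>
        rename_i a b
        obtain ⟨haQ, haX⟩ := hreach a ((SimpleGraph.reachable_iff_reflTransGen _ _).2 hua)
        have hbQ : q b = Q := (hqadj _ _ hab.1).symm.trans haQ
        rcases hstep a b hab haQ with h | h | h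
        · have := hlowhigh a b haQ haX hbQ hab.2.2 h
          exact ih.imp this.1 this.2
        · exact Or.inr h.2
        · exact Or.inl h.1
    constructor
    · by_cases hl : low u ∨ high u
      · have h1 : ({w | (cutAt M X).Reachable u w} : Finset V) ⊆
            ({w | q w = Q ∧ low w} : Finset V) ∪ ({w | q w = Q ∧ high w} : Finset V) := by
          intro w hw
          simp only [mem_filter, mem_univ, true_and, mem_union] at hw ⊢
          have h2 := hends hl w hw
          have h3 := (hreach w hw).1
          tauto
        have h2 := hcardlow {w | q w = Q ∧ low w} (by simp)
        have h3 := hcardhigh {w | q w = Q ∧ high w} (by simp)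
        have h4 := (card_le_card h1).trans (card_union_le _ _)
        omega
      · push Not at hl
        obtain ⟨hl, hh⟩ := hl
        have hs := hsame hl hh
        simp only [hlow, hhigh, not_forall, not_lt] at hl hh
        obtain ⟨j₀, hj₀, h1⟩ := hl
        obtain ⟨j₁, hj₁, h2⟩ := hh
        have hj₀' := hc3 j₀ hj₀ u rfl hu
        have hj₁' := hc3 j₁ hj₁ u rfl hu
        have hex : ∃ j, j < m Q ∧ idx u < c j := ⟨j₁, hj₁, by omega⟩
        obtain ⟨hj, hju⟩ := Nat.find_spec hex
        have hmin := fun i => Nat.find_min hex (m := i)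
        generalize Nat.find hex = j at hj hju hmin
        rcases Nat.eq_zero_or_pos j with rfl | hjpos
        · exfalso
          rcases Nat.eq_zero_or_pos j₀ with rfl | h
          · omega
          · have h3 := hc1 j₀ hj₀
            have h4 := hc2 0 hj
            have : n ≤ j₀ * n := Nat.le_mul_of_pos_left n h
            omega
        · have h3 : c (j - 1) < idx u := by
            have h4 := hmin (j - 1) (by omega)
            have h5 := hc3 (j - 1) (by omega) u rfl hu
            have h6 : j - 1 < m Q := by omega
            have h7 : ¬ idx u < c (j - 1) := fun h => h4 ⟨h6, h⟩
            omega
          refine (hcount Q _ (Ioo (c (j - 1)) (c j)) fun w hw => ?_).trans ?_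
          · simp only [mem_filter, mem_univ, true_and] at hw
            have h4 := hreach w hw
            have h5 := hs w hw
            have h6 := h5 j hj
            have h7 := h5 (j - 1) (by omega)
            have h8 := hc3 j hj w h4.1 h4.2
            exact ⟨h4.1, mem_Ioo.2 ⟨by omega, by omega⟩⟩
          · have h4 := hc1 (j - 1) (by omega)
            have h5 := hc2 j hj
            have h6 : (j + 1) * n = (j - 1) * n + 2 * n := by
              rw [← Nat.add_mul]
              congr 1
              omega
            rw [Nat.card_Ioo]
            omega
    · intro x hux hx
      obtain ⟨hxQ, hxX⟩ := hreach x hux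
      have hxN := hidx x
      rw [hxQ] at hxN
      have hx2 : idx x = 0 ∨ idx x + 1 = N Q := by
        by_contra! hcon
        have := hdeg x (by omega) (by rw [hxQ]; omega)
        omega
      have hnocyc : ∀ a b, (cutAt M X).Adj a b → q a = Q →
          ∀ j < m Q, c j < idx a ↔ c j < idx b := by
        -- If more than two vertices were closed up into a cycle, both ends would have degree two,
        -- contradicting the choice of `x`. With only two vertices there are no segments, hence no
        -- cuts to separate anything.
        have hN : ∀ a b, M.Adj a b → q a = Q → idx a = 0 → idx b + 1 = N Q → N Q = 2 := by
          intro a b hab ha ha0 hbN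
          have hb : q b = Q := (hqadj _ _ hab).symm.trans ha
          by_contra hN2
          have hN0 : 2 < N Q := by
            have : idx a ≠ idx b := fun h => hab.ne (by rw [← hgidx a, ← hgidx b, ha, hb, h])
            omega
          have h2 : 2 ≤ #{w | M.Adj x w} := by
            rcases hx2 with h | h
            · have hxa : x = a := by rw [← hgidx a, ← hgidx x, ha, hxQ, h, ha0]
              have h3 := hadj Q 0 (by omega)
              have h4 : g Q 0 = a := by rw [← hgidx a, ha, ha0]
              have h5 := hidxg Q 1 (by omega)
              rw [h4] at h3
              rw [← card_pair (a := b) (b := g Q (0 + 1))]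
              · refine card_le_card fun y hy => ?_
                simp only [mem_insert, mem_singleton] at hy
                rcases hy with rfl | rfl
                · simpa [hxa] using hab
                · simpa [hxa] using h3
              · intro h
                rw [zero_add] at h
                rw [← h] at h5
                omega
            · have hxb : x = b := by
                rw [← hgidx b, ← hgidx x, hb, hxQ]
                congr 1
                omega
              have h3 := hadj Q (N Q - 2) (by omega)
              have h4 : g Q (N Q - 2 + 1) = b := by
                rw [← hgidx b, hb]
                congr 1
                omega
              have h5 := hidxg Q (N Q - 2) (by omega)
              rw [h4] at h3
              rw [← card_pair (a := a) (b := g Q (N Q - 2))]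
              · refine card_le_card fun y hy => ?_
                simp only [mem_insert, mem_singleton] at hy
                rcases hy with rfl | rfl
                · simpa [hxb] using hab.symm
                · simpa [hxb] using h3.symm
              · intro h
                rw [← h] at h5
                omega
          omega
        intro a b hab ha
        have hb : q b = Q := (hqadj _ _ hab.1).symm.trans ha
        have hNm' := hNm Q
        have hzero : N Q = 2 → m Q = 0 := by
          intro h
          simp [hm, h]
        rcases hidxadj a b hab.1 with h | h | ⟨h1, h2⟩ | ⟨h1, h2⟩
        · intro j hj
          have := hc3 j hj a ha hab.2.1
          omega
        · intro j hj
          have := hc3 j hj b hb hab.2.2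
          omega
        · have := hzero (hN a b hab.1 ha h1 (by rw [← ha]; exact h2))
          intro j hj
          omega
        · have := hzero (hN b a hab.1.symm hb h1 (by rw [← ha]; exact h2))
          intro j hj
          omega
      have hall : ∀ w, (cutAt M X).Reachable u w → ∀ j < m Q, c j < idx u ↔ c j < idx w := by
        intro w hw
        rw [SimpleGraph.reachable_iff_reflTransGen] at hw
        induction hw with
        | refl => exact fun _ _ => Iff.rfl
        | tail hua hab ih =>
          have haQ := (hreach _ ((SimpleGraph.reachable_iff_reflTransGen _ _).2 hua)).1
          exact fun j hj => (ih j hj).trans (hnocyc _ _ hab haQ j hj)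
      have hallx : ∀ w, (cutAt M X).Reachable u w →
          (low x → low w) ∧ (high x → high w) := fun w hw =>
        hlowhigh x w hxQ hxX (hreach w hw).1 (hreach w hw).2 fun j hj =>
          (hall x hux j hj).symm.trans (hall w hw j hj)
      rcases hx2 with h | h
      · refine hcardlow _ fun w hw => ?_
        simp only [mem_filter, mem_univ, true_and] at hw
        exact ⟨(hreach w hw).1, (hallx w hw).1 (hlow0 x h)⟩
      · refine hcardhigh _ fun w hw => ?_
        simp only [mem_filter, mem_univ, true_and] at hw
        exact ⟨(hreach w hw).1, (hallx w hw).2 (hhighN x hxQ h)⟩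

/-! ### Bounding components, and the ends of paths. -/

section Reachable

theorem card_reachable_le {V : Type*} [Fintype V] (M : SimpleGraph V) (R : Finset V) {u : V}
    (hu : u ∈ R) (hR : ∀ a ∈ R, ∀ b, M.Adj a b → b ∈ R) : #{w | M.Reachable u w} ≤ #R := by
  refine card_le_card fun w hw => ?_
  simp only [mem_filter, mem_univ, true_and, SimpleGraph.reachable_iff_reflTransGen] at hw
  induction hw with
  | refl => exact hu
  | tail _ hab ih => exact hR _ ih _ hab

theorem eq_of_reachable_of_card_eq_zero {V : Type*} [Fintype V] (M : SimpleGraph V) {x y : V}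
    (hx : #{w | M.Adj x w} = 0) (hxy : M.Reachable x y) : y = x := by
  rw [SimpleGraph.reachable_iff_reflTransGen] at hxy
  rcases Relation.ReflTransGen.cases_head hxy with h | ⟨z, hz, -⟩
  · exact h.symm
  · rw [card_eq_zero, filter_eq_empty_iff] at hx
    exact absurd hz (hx (mem_univ z))

/-- A component of a graph of maximum degree at most two has at most two vertices of degree at
most one. -/
theorem card_ends_le {V : Type*} [Fintype V] (M : SimpleGraph V)
    (hM : ∀ v, #{w | M.Adj v w} ≤ 2) (x : V) :
    #{y | M.Reachable x y ∧ #{w | M.Adj y w} ≤ 1} ≤ 2 := by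
  obtain ⟨N, g, -, hinj, hsurj, hadj, -⟩ :=
    exists_path_enumeration M hM (M.connectedComponentMk x)
  refine (card_le_card (t := {g 0, g (N - 1)}) fun y hy => ?_).trans card_le_two
  simp only [mem_filter, mem_univ, true_and] at hy
  obtain ⟨i, hi, rfl⟩ := hsurj y (SimpleGraph.ConnectedComponent.sound hy.1).symm
  have h1 : i = 0 ∨ i = N - 1 := by
    by_contra! hcon
    have h2 := hadj (i - 1) (by omega)
    rw [show i - 1 + 1 = i by omega] at h2
    have h3 := hadj i (by omega)
    have h4 : #{g (i - 1), g (i + 1)} ≤ 1 := (card_le_card fun z hz => by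
      simp only [mem_insert, mem_singleton] at hz
      rcases hz with rfl | rfl
      · simpa using h2.symm
      · simpa using h3).trans hy.2
    rw [card_pair fun h => by
      have := hinj (i - 1) (by omega) (i + 1) (by omega) h
      omega] at h4
    omega
  rcases h1 with rfl | rfl <;> simp

theorem eq_of_reachable_monochromaticSubgraph {V : Type*} {C : Type*} {H : SimpleGraph V} {φ : V → C} {x y : V}
    (h : (monochromaticSubgraph H φ).Reachable x y) : φ x = φ y := by
  rw [SimpleGraph.reachable_iff_reflTransGen] at h
  induction h with
  | refl => rfl
  | tail _ hab ih => exact ih.trans hab.2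

end Reachable

/-! ### Colourings with fewest monochromatic edges, and their options. -/

section ColourDegree

variable {W : Type*} {C : Type*} [Fintype W]

/-- The number of neighbours of `v` of colour `c`. -/
noncomputable def colourDegree (H : SimpleGraph W) (φ : W → C) (v : W) (c : C) : ℕ :=
  #{w | H.Adj v w ∧ φ w = c}

/-- Twice the number of monochromatic edges. -/
noncomputable def monochromaticSum (H : SimpleGraph W) (φ : W → C) : ℕ :=
  ∑ v, colourDegree H φ v (φ v)

theorem sum_sum_eq_erase (v : W) (f : W → W → ℕ) (hf : ∀ a b, f a b = f b a) (hv : f v v = 0) :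
    ∑ a, ∑ b, f a b =
      ∑ a ∈ univ.erase v, ∑ b ∈ univ.erase v, f a b + 2 * ∑ b ∈ univ.erase v, f v b := by
  have h1 : ∀ a, ∑ b, f a b = ∑ b ∈ univ.erase v, f a b + f a v := fun a =>
    (sum_erase_add _ _ (mem_univ v)).symm
  rw [← sum_erase_add _ _ (mem_univ v), h1 v, hv, sum_congr rfl fun a _ => h1 a,
    sum_add_distrib, sum_congr rfl fun a _ => hf a v]
  ring

/-- Only edges at `v` are affected, and each is counted from both of its ends. -/
theorem monochromaticSum_update (H : SimpleGraph W) (φ : W → C) (v : W) (b : C) :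
    monochromaticSum H (Function.update φ v b) + 2 * colourDegree H φ v (φ v) =
      monochromaticSum H φ + 2 * colourDegree H φ v b := by
  have key : ∀ ψ : W → C, monochromaticSum H ψ =
      ∑ x ∈ univ.erase v, ∑ y ∈ univ.erase v, (if H.Adj x y ∧ ψ y = ψ x then 1 else 0) +
        2 * colourDegree H ψ v (ψ v) := by
    intro ψ
    have h1 : colourDegree H ψ v (ψ v) =
        ∑ y ∈ univ.erase v, if H.Adj v y ∧ ψ y = ψ v then 1 else 0 := by
      rw [colourDegree, card_filter, ← sum_erase_add _ _ (mem_univ v)]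
      simp
    rw [h1, ← sum_sum_eq_erase v (fun x y => if H.Adj x y ∧ ψ y = ψ x then 1 else 0)]
    · exact sum_congr rfl fun x _ => by rw [colourDegree, card_filter]
    · intro x y
      simp only [H.adj_comm, eq_comm]
    · simp
  have hcol : colourDegree H (Function.update φ v b) v (Function.update φ v b v) =
      colourDegree H φ v b := by
    unfold colourDegree
    congr 1
    ext w
    simp only [mem_filter, mem_univ, true_and, Function.update_self]
    refine and_congr_right fun h => ?_
    rw [Function.update_of_ne h.ne']
  have hrest : ∑ x ∈ univ.erase v, ∑ y ∈ univ.erase v, (if H.Adj x y ∧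
      Function.update φ v b y = Function.update φ v b x then 1 else 0) =
      ∑ x ∈ univ.erase v, ∑ y ∈ univ.erase v, (if H.Adj x y ∧ φ y = φ x then 1 else 0) := by
    refine sum_congr rfl fun x hx => sum_congr rfl fun y hy => ?_
    rw [Function.update_of_ne (ne_of_mem_erase hx), Function.update_of_ne (ne_of_mem_erase hy)]
  rw [key (Function.update φ v b), key φ, hcol, hrest]
  ring

/-- `φ` has the minimum number of monochromatic edges among all `L`-colourings. -/
def IsMinColouring (H : SimpleGraph W) (L : W → Finset C) (φ : W → C) : Prop :=
  (∀ v, φ v ∈ L v) ∧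
    ∀ ψ : W → C, (∀ v, ψ v ∈ L v) → monochromaticSum H φ ≤ monochromaticSum H ψ

theorem exists_isMinColouring (H : SimpleGraph W) (L : W → Finset C) (hL : ∀ v, (L v).Nonempty) :
    ∃ φ, IsMinColouring H L φ := by
  obtain ⟨φ, hφ, hmin⟩ := exists_min_image (Fintype.piFinset L) (monochromaticSum H)
    (Fintype.piFinset_nonempty.2 hL)
  exact ⟨φ, Fintype.mem_piFinset.1 hφ, fun ψ hψ => hmin ψ (Fintype.mem_piFinset.2 hψ)⟩

/-- The sparsity condition under which the colouring argument works. -/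
def IsSparse (H : SimpleGraph W) (L : W → Finset C) : Prop :=
  ∀ S : Finset W, S.Nonempty →
    ∑ v ∈ S, (#{w | H.Adj v w} + #{w ∈ S | H.Adj v w}) < 3 * ∑ v ∈ S, #(L v)

/-- Recolouring `v` with `b` does not change the number of monochromatic edges, and `v` is
on a monochromatic path or cycle both before and after it. -/
def IsOption (H : SimpleGraph W) (L : W → Finset C) (φ : W → C) (v : W) (b : C) : Prop :=
  b ∈ L v ∧ b ≠ φ v ∧ colourDegree H φ v (φ v) = 2 ∧ colourDegree H φ v b = 2

variable {H : SimpleGraph W} {L : W → Finset C} {φ : W → C}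

theorem IsSparse.card_lt (hL : IsSparse H L) (v : W) : #{w | H.Adj v w} < 3 * #(L v) := by
  have := hL {v} (singleton_nonempty v)
  simp only [sum_singleton] at this
  omega

theorem IsSparse.nonempty (hL : IsSparse H L) (v : W) : (L v).Nonempty := by
  have := hL.card_lt v
  exact card_pos.1 (by omega)

theorem sum_colourDegree_le (H : SimpleGraph W) (φ : W → C) (v : W) (s : Finset C) :
    ∑ c ∈ s, colourDegree H φ v c ≤ #{w | H.Adj v w} := by
  have h1 : ∀ c ∈ s, colourDegree H φ v c =
      #{w ∈ ({w | H.Adj v w ∧ φ w ∈ s} : Finset W) | φ w = c} := by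
    intro c hc
    unfold colourDegree
    congr 1
    ext w
    simp only [mem_filter, mem_univ, true_and]
    constructor
    · rintro ⟨h1, rfl⟩
      exact ⟨⟨h1, hc⟩, rfl⟩
    · rintro ⟨⟨h1, -⟩, h2⟩
      exact ⟨h1, h2⟩
  rw [sum_congr rfl h1]
  refine (card_eq_sum_card_fiberwise fun w hw => (mem_filter.1 hw).2.2).ge.trans ?_
  exact card_le_card fun w hw => by
    simp only [mem_filter, mem_univ, true_and] at hw ⊢
    exact hw.1

namespace IsMinColouring

theorem colourDegree_le (hφ : IsMinColouring H L φ) {v : W} {b : C} (hb : b ∈ L v) :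
    colourDegree H φ v (φ v) ≤ colourDegree H φ v b := by
  have h1 := monochromaticSum_update H φ v b
  have h2 := hφ.2 (Function.update φ v b) fun w => by
    by_cases h : w = v
    · subst h
      simpa using hb
    · simpa [h] using hφ.1 w
  omega

theorem card_mul_le (hφ : IsMinColouring H L φ) (v : W) :
    #(L v) * colourDegree H φ v (φ v) ≤ #{w | H.Adj v w} := by
  rw [← smul_eq_mul]
  exact (card_nsmul_le_sum _ _ _ fun c hc => hφ.colourDegree_le hc).trans
    (sum_colourDegree_le H φ v (L v))

theorem colourDegree_le_two (hφ : IsMinColouring H L φ) (hL : IsSparse H L) (v : W) :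
    colourDegree H φ v (φ v) ≤ 2 := by
  have h1 := hφ.card_mul_le v
  have h2 := hL.card_lt v
  by_contra! h3
  have h4 : #(L v) * 3 ≤ #(L v) * colourDegree H φ v (φ v) := Nat.mul_le_mul_left _ h3
  omega

/-- Recolouring an option trades two monochromatic edges for two others. Independence of `I` keeps
the colour degrees at its remaining members unchanged, so the trades can be made one after another.
-/
theorem recolour (hφ : IsMinColouring H L φ) (b : C) (I : Finset W)
    (hI : ∀ v ∈ I, IsOption H L φ v b) (hind : ∀ v ∈ I, ∀ w ∈ I, ¬ H.Adj v w) :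
    IsMinColouring H L fun v => if v ∈ I then b else φ v := by
  induction I using Finset.induction_on with
  | empty => simpa using hφ
  | insert v I hv ih =>
    have h1 := ih (fun w hw => hI w (mem_insert_of_mem hw))
      fun x hx y hy => hind x (mem_insert_of_mem hx) y (mem_insert_of_mem hy)
    set ψ : W → C := fun v => if v ∈ I then b else φ v with hψ
    have hψv : ψ v = φ v := if_neg hv
    have hcd : ∀ c, colourDegree H ψ v c = colourDegree H φ v c := by
      intro c
      unfold colourDegree
      congr 1
      ext w
      simp only [mem_filter, mem_univ, true_and]
      refine and_congr_right fun h => ?_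
      have : w ∉ I := fun hw => hind v (mem_insert_self _ _) w (mem_insert_of_mem hw) h
      simp [hψ, this]
    have heq : (fun w => if w ∈ insert v I then b else φ w) = Function.update ψ v b := by
      ext w
      by_cases hw : w = v
      · simp [hw]
      · simp [hw, hψ]
    obtain ⟨hb, -, h2, h3⟩ := hI v (mem_insert_self _ _)
    have h4 := monochromaticSum_update H ψ v b
    rw [hψv, hcd, hcd, h2, h3] at h4
    rw [heq]
    refine ⟨fun w => ?_, fun χ hχ => ?_⟩
    · by_cases h : w = v
      · subst h
        simpa using hb
      · simpa [h] using h1.1 w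
    · have := h1.2 χ hχ
      omega

/-- Recolouring all of `I` with the colour of `x` gives another minimal colouring, in which `x` has
gained `#I` neighbours of its colour and still has at most two. -/
theorem colourDegree_add_card_le_two (hφ : IsMinColouring H L φ) (hL : IsSparse H L) (x : W)
    (I : Finset W) (hI : ∀ v ∈ I, IsOption H L φ v (φ x)) (hx : ∀ v ∈ I, H.Adj x v)
    (hind : ∀ v ∈ I, ∀ w ∈ I, ¬ H.Adj v w) : colourDegree H φ x (φ x) + #I ≤ 2 := by
  have h1 := (hφ.recolour (φ x) I hI hind).colourDegree_le_two hL x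
  refine le_trans (le_of_eq ?_) h1
  simp only [ite_self]
  unfold colourDegree
  rw [← card_union_of_disjoint]
  · congr 1
    ext w
    simp only [mem_union, mem_filter, mem_univ, true_and]
    by_cases hw : w ∈ I
    · simp [hw, hx w hw]
    · simp [hw]
  · refine disjoint_left.2 fun w hw hwI => ?_
    exact (hI w hwI).2.1 (mem_filter.1 hw).2.2.symm

theorem colourDegree_le_one (hφ : IsMinColouring H L φ) (hL : IsSparse H L) {x v : W}
    (hv : IsOption H L φ v (φ x)) (hx : H.Adj x v) : colourDegree H φ x (φ x) ≤ 1 := by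
  have := hφ.colourDegree_add_card_le_two hL x {v} (by simpa using hv) (by simpa using hx)
    (by simp)
  rw [card_singleton] at this
  omega

/-- A vertex with an option has monochromatic degree 2, so deg v ≥ 2|L(v)|. This uses up two thirds
of the sparsity bound and leaves less than ∑|L(v)| for the degrees inside `T`. -/
theorem sum_card_adj_lt (hφ : IsMinColouring H L φ) (hL : IsSparse H L) {k : ℕ}
    (hk : ∀ v, #(L v) ≤ k) (b : C) (T : Finset W) (hT : ∀ v ∈ T, IsOption H L φ v b)
    (hne : T.Nonempty) : ∑ v ∈ T, #{w ∈ T | H.Adj v w} < #T * k := by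
  have h1 := hL T hne
  rw [sum_add_distrib] at h1
  have h2 : 2 * ∑ v ∈ T, #(L v) ≤ ∑ v ∈ T, #{w | H.Adj v w} := by
    rw [mul_sum]
    refine sum_le_sum fun v hv => ?_
    have := hφ.card_mul_le v
    rw [(hT v hv).2.2.1] at this
    omega
  have h3 : ∑ v ∈ T, #(L v) ≤ #T * k := by
    rw [← smul_eq_mul]
    exact sum_le_card_nsmul _ _ _ fun v _ => hk v
  omega

theorem card_clique_le (hφ : IsMinColouring H L φ) (hL : IsSparse H L) {k : ℕ}
    (hk : ∀ v, #(L v) ≤ k) (b : C) (T : Finset W) (hT : ∀ v ∈ T, IsOption H L φ v b)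
    (hcl : ∀ v ∈ T, ∀ w ∈ T, v ≠ w → H.Adj v w) : #T ≤ k := by
  rcases T.eq_empty_or_nonempty with rfl | hne
  · simp
  have h1 := hφ.sum_card_adj_lt hL hk b T hT hne
  have h2 : #T * (#T - 1) ≤ ∑ v ∈ T, #{w ∈ T | H.Adj v w} := by
    rw [← smul_eq_mul]
    refine card_nsmul_le_sum _ _ _ fun v hv => ?_
    rw [← card_erase_of_mem hv]
    refine card_le_card fun w hw => ?_
    obtain ⟨hwv, hwT⟩ := mem_erase.1 hw
    exact mem_filter.2 ⟨hwT, hcl v hv w hwT hwv.symm⟩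
  have := lt_of_mul_lt_mul_left (h2.trans_lt h1) (Nat.zero_le _)
  omega

/-- Three pairwise non-adjacent options at `x` would give `x` three neighbours of its colour. So the
non-neighbours of any `v` in `T` form a clique of at most `k` vertices, and degrees inside `T` are
at least #T - 1 - k; their average is below `k`. If `x` already has one such neighbour, `T` itself
is a clique. -/
theorem card_options_at_le (hφ : IsMinColouring H L φ) (hL : IsSparse H L) {k : ℕ}
    (hk : ∀ v, #(L v) ≤ k) (x : W) :
    #{v | IsOption H L φ v (φ x) ∧ H.Adj v x} ≤ 2 * k ∧ (colourDegree H φ x (φ x) = 1 →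
      #{v | IsOption H L φ v (φ x) ∧ H.Adj v x} ≤ k) := by
  set T : Finset W := {v | IsOption H L φ v (φ x) ∧ H.Adj v x} with hT
  have hT1 : ∀ v ∈ T, IsOption H L φ v (φ x) := fun v hv => (mem_filter.1 hv).2.1
  have hT2 : ∀ v ∈ T, H.Adj x v := fun v hv => (mem_filter.1 hv).2.2.symm
  constructor
  · rcases T.eq_empty_or_nonempty with h0 | hne
    · simp [h0]
    have h1 := hφ.sum_card_adj_lt hL hk (φ x) T hT1 hne
    have h2 : #T * (#T - (k + 1)) ≤ ∑ v ∈ T, #{w ∈ T | H.Adj v w} := by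
      rw [← smul_eq_mul]
      refine card_nsmul_le_sum _ _ _ fun v hv => ?_
      have h3 : #{w ∈ T.erase v | ¬ H.Adj v w} ≤ k := by
        refine hφ.card_clique_le hL hk (φ x) _
          (fun w hw => hT1 w (mem_of_mem_erase (mem_filter.1 hw).1)) ?_
        intro a ha b hb hab
        obtain ⟨ha1, ha2⟩ := mem_filter.1 ha
        obtain ⟨hb1, hb2⟩ := mem_filter.1 hb
        obtain ⟨ha3, ha4⟩ := mem_erase.1 ha1
        obtain ⟨hb3, hb4⟩ := mem_erase.1 hb1
        by_contra hnadj
        have h4 := hφ.colourDegree_add_card_le_two hL x {v, a, b}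
          (by simp [hT1 v hv, hT1 a ha4, hT1 b hb4])
          (by simp [hT2 v hv, hT2 a ha4, hT2 b hb4])
          (by simp [ha2, hb2, hnadj, H.adj_comm a v, H.adj_comm b v, H.adj_comm b a])
        rw [card_eq_three.2 ⟨v, a, b, ha3.symm, hb3.symm, hab, rfl⟩] at h4
        omega
      have h5 := card_filter_add_card_filter_not (s := T.erase v) fun w => H.Adj v w
      have h6 : #{w ∈ T.erase v | H.Adj v w} ≤ #{w ∈ T | H.Adj v w} :=
        card_le_card (filter_subset_filter _ (erase_subset _ _))
      rw [card_erase_of_mem hv] at h5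
      omega
    have := lt_of_mul_lt_mul_left (h2.trans_lt h1) (Nat.zero_le _)
    omega
  · intro h1
    refine hφ.card_clique_le hL hk (φ x) T hT1 fun v hv w hw hvw => ?_
    by_contra hnadj
    have h4 := hφ.colourDegree_add_card_le_two hL x {v, w}
      (by simp [hT1 v hv, hT1 w hw]) (by simp [hT2 v hv, hT2 w hw])
      (by simp [hnadj, H.adj_comm w v])
    rw [card_pair hvw] at h4
    omega

/-- By minimality `v` sees each colour of its list at least twice, and at least three times unless
the colour is an option or its own. Summing over the list bounds deg v from below. -/
theorem card_le_card_options (hφ : IsMinColouring H L φ) {v : W}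
    (hv : colourDegree H φ v (φ v) = 2) :
    3 * #(L v) ≤ #{w | H.Adj v w} + #{b ∈ L v | IsOption H L φ v b} + 1 := by
  have h1 := sum_colourDegree_le H φ v (L v)
  have h2 : ∑ c ∈ L v, (3 - (if IsOption H L φ v c then 1 else 0) - (if c = φ v then 1 else 0)) ≤
      ∑ c ∈ L v, colourDegree H φ v c := by
    refine sum_le_sum fun c hc => ?_
    by_cases h3 : c = φ v
    · rw [h3, hv]
      simp
    · have h4 := hφ.colourDegree_le hc
      rw [hv] at h4
      by_cases h5 : IsOption H L φ v c
      · simp [h5, h3, h4]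
      · have : colourDegree H φ v c ≠ 2 := fun h => h5 ⟨hc, h3, hv, h⟩
        simp only [h5, h3, if_false]
        omega
  have h3 : ∑ c ∈ L v, 3 ≤ ∑ c ∈ L v, (3 - (if IsOption H L φ v c then 1 else 0) -
      (if c = φ v then 1 else 0)) + ∑ c ∈ L v, (if IsOption H L φ v c then 1 else 0) +
      ∑ c ∈ L v, (if c = φ v then 1 else 0) := by
    rw [← sum_add_distrib, ← sum_add_distrib]
    refine sum_le_sum fun c _ => ?_
    split_ifs <;> omega
  rw [← card_filter, ← card_filter, sum_const, smul_eq_mul] at h3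
  have h4 : #{c ∈ L v | c = φ v} ≤ 1 := card_le_one.2 fun a ha b hb =>
    (mem_filter.1 ha).2.trans (mem_filter.1 hb).2.symm
  omega

end IsMinColouring

theorem card_monochromaticSubgraph_adj (H : SimpleGraph W) (φ : W → C) (v : W) :
    #{w | (monochromaticSubgraph H φ).Adj v w} = colourDegree H φ v (φ v) := by
  unfold colourDegree
  congr 1
  ext w
  simp only [mem_filter, mem_univ, true_and]
  exact and_congr_right fun _ => eq_comm

/-! ### Conflicts between options. -/

/-- Two options conflict if carrying out both of them could merge monochromatic components
in an uncontrolled way. -/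
def conflictGraph (H : SimpleGraph W) (L : W → Finset C) (φ : W → C) : SimpleGraph (W × C) where
  Adj p q := p ≠ q ∧ p.2 = q.2 ∧ IsOption H L φ p.1 p.2 ∧ IsOption H L φ q.1 q.2 ∧
    (H.Adj p.1 q.1 ∨ ∃ x y, H.Adj p.1 x ∧ φ x = p.2 ∧ H.Adj q.1 y ∧ φ y = q.2 ∧
      (monochromaticSubgraph H φ).Reachable x y)
  symm := ⟨fun _ _ ⟨h1, h2, h3, h4, h5⟩ => ⟨h1.symm, h2.symm, h4, h3, h5.imp
    (fun h => h.symm) fun ⟨x, y, h6, h7, h8, h9, h10⟩ => ⟨y, x, h8, h9, h6, h7, h10.symm⟩⟩⟩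
  loopless := ⟨fun _ h => h.1 rfl⟩

namespace IsMinColouring

/-- Options attach only at vertices of monochromatic degree at most one. These are either a single
isolated vertex, with up to 2k options, or at most two path ends with up to `k` each; a cycle admits
none. -/
theorem card_options_near_le (hφ : IsMinColouring H L φ) (hL : IsSparse H L) {k : ℕ}
    (hk : ∀ v, #(L v) ≤ k) (x : W) :
    #{v | IsOption H L φ v (φ x) ∧ ∃ y, H.Adj v y ∧ φ y = φ x ∧
      (monochromaticSubgraph H φ).Reachable x y} ≤ 2 * k := by
  set M := monochromaticSubgraph H φ with hM
  have hMdeg : ∀ v, #{w | M.Adj v w} ≤ 2 := fun v => by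
    rw [card_monochromaticSubgraph_adj]
    exact hφ.colourDegree_le_two hL v
  rcases Nat.eq_zero_or_pos (colourDegree H φ x (φ x)) with h0 | h0
  · refine (card_le_card fun v hv => ?_).trans (hφ.card_options_at_le hL hk x).1
    simp only [mem_filter, mem_univ, true_and] at hv ⊢
    obtain ⟨hv, y, hvy, -, hxy⟩ := hv
    rw [← card_monochromaticSubgraph_adj] at h0
    rw [eq_of_reachable_of_card_eq_zero M h0 hxy] at hvy
    exact ⟨hv, hvy⟩
  · set Y : Finset W := {y | M.Reachable x y ∧ #{w | M.Adj y w} ≤ 1} with hY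
    refine (card_le_card (t := Y.biUnion fun y => {v | IsOption H L φ v (φ y) ∧ H.Adj v y})
      fun v hv => ?_).trans
      ((card_biUnion_le_card_mul _ _ k fun y hy => ?_).trans
        (Nat.mul_le_mul_right _ (card_ends_le M hMdeg x)))
    · simp only [mem_filter, mem_univ, true_and] at hv
      obtain ⟨hv, y, hvy, hyx, hxy⟩ := hv
      rw [mem_biUnion]
      refine ⟨y, mem_filter.2 ⟨mem_univ _, hxy, ?_⟩, ?_⟩
      · rw [card_monochromaticSubgraph_adj]
        exact hφ.colourDegree_le_one hL (by rwa [hyx]) hvy.symm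
      · simp only [mem_filter, mem_univ, true_and]
        rw [hyx]
        exact ⟨hv, hvy⟩
    · obtain ⟨-, hxy, hy⟩ := mem_filter.1 hy
      refine (hφ.card_options_at_le hL hk y).2 ?_
      rw [card_monochromaticSubgraph_adj] at hy
      refine le_antisymm hy (Nat.pos_of_ne_zero fun h => ?_)
      rw [← card_monochromaticSubgraph_adj] at h
      rw [eq_of_reachable_of_card_eq_zero M h hxy.symm, ← card_monochromaticSubgraph_adj] at h0
      exact h0.ne' h

/-- Of fewer than 3k neighbours of `v`, the two of colour `b` have no option `b`, leaving at most 3k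
- 3. The components of those two neighbours contribute at most 2k - 1 options each besides `v`
itself. -/
theorem card_conflicts_le [Fintype C] (hφ : IsMinColouring H L φ) (hL : IsSparse H L) {k : ℕ}
    (hk : ∀ v, #(L v) ≤ k) (p : W × C) :
    #{q | (conflictGraph H L φ).Adj p q} ≤ 7 * k - 5 := by
  obtain ⟨v, b⟩ := p
  by_cases hp : IsOption H L φ v b
  swap
  · rw [card_eq_zero.2 (filter_eq_empty_iff.2 fun q _ h => hp h.2.2.1)]
    exact Nat.zero_le _
  set T : Finset W := {x | H.Adj v x ∧ φ x = b} with hT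
  have hTcard : #T = 2 := hp.2.2.2
  set near : W → Finset W := fun x => {v | IsOption H L φ v (φ x) ∧ ∃ y, H.Adj v y ∧ φ y = φ x ∧
      (monochromaticSubgraph H φ).Reachable x y} with hnear
  have h1 : #{w | H.Adj v w ∧ ¬ φ w = b} + 2 < 3 * k := by
    have h2 := card_filter_add_card_filter_not (s := ({w | H.Adj v w} : Finset W)) fun w => φ w = b
    rw [filter_filter, filter_filter] at h2
    have h3 := hL.card_lt v
    have h4 := hk v
    rw [hT] at hTcard
    omega
  have h2 : #(T.biUnion fun x => (near x).erase v) ≤ 2 * (2 * k - 1) := by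
    rw [← hTcard]
    refine card_biUnion_le_card_mul _ _ _ fun x hx => ?_
    obtain ⟨-, hvx, hxb⟩ := mem_filter.1 hx
    rw [card_erase_of_mem (by
      simp only [hnear, mem_filter, mem_univ, true_and]
      exact ⟨by rwa [hxb], x, hvx, rfl, SimpleGraph.Reachable.refl _⟩)]
    rw [hTcard]
    exact Nat.sub_le_sub_right (hφ.card_options_near_le hL hk x) 1
  have h3 : ({q | (conflictGraph H L φ).Adj (v, b) q} : Finset (W × C)) ⊆
      (({w | H.Adj v w ∧ ¬ φ w = b} : Finset W) ∪ T.biUnion fun x => (near x).erase v).image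
        fun w => (w, b) := by
    rintro ⟨w, c⟩ hq
    simp only [mem_filter, mem_univ, true_and] at hq
    obtain ⟨hne, rfl, -, hw, h4⟩ := hq
    refine mem_image.2 ⟨w, mem_union.2 ?_, rfl⟩
    have hne' : w ≠ v := fun h => hne (by simp [h])
    rcases h4 with h4 | ⟨x, y, h5, h6, h7, h8, h9⟩
    · exact Or.inl (by simpa using ⟨h4, fun h => hw.2.1 h.symm⟩)
    · refine Or.inr (mem_biUnion.2 ⟨x, by simpa [hT] using ⟨h5, h6⟩, mem_erase.2 ⟨hne', ?_⟩⟩)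
      simp only [hnear, mem_filter, mem_univ, true_and]
      simp only at h6 h8
      rw [h6]
      exact ⟨hw, y, h7, h8, h9⟩
  have h4 := (card_le_card h3).trans (card_image_le.trans (card_union_le _ _))
  omega

end IsMinColouring

end ColourDegree

/-! ### Colouring sparse graphs with bounded clustering. -/

section Clustering

theorem HasClustering.comp_injective {W C C' : Type*} {H : SimpleGraph W} {φ : W → C} {c : ℕ}
    (h : HasClustering H φ c) {g : C → C'} (hg : Function.Injective g) :
    HasClustering H (g ∘ φ) c := by
  have : monochromaticSubgraph H (g ∘ φ) = monochromaticSubgraph H φ := by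
    ext a b
    exact and_congr_right fun _ => hg.eq_iff
  rw [HasClustering, this]
  exact h

variable {W : Type*} {C : Type*} [Fintype W]

theorem hasClustering_iff (H : SimpleGraph W) (φ : W → C) (c : ℕ) :
    HasClustering H φ c ↔ ∀ u, #{w | (monochromaticSubgraph H φ).Reachable u w} ≤ c := by
  have key : ∀ u, ((monochromaticSubgraph H φ).connectedComponentMk u).supp.encard =
      (#{w | (monochromaticSubgraph H φ).Reachable u w} : ℕ∞) := by
    intro u
    rw [← Set.encard_coe_eq_coe_finsetCard]
    congr 1
    ext w
    simp only [SimpleGraph.ConnectedComponent.mem_supp_iff, SimpleGraph.ConnectedComponent.eq,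
      coe_filter, mem_univ, true_and, Set.mem_ofPred_eq]
    exact ⟨fun h => h.symm, fun h => h.symm⟩
  constructor
  · intro h u
    have := h ((monochromaticSubgraph H φ).connectedComponentMk u)
    rw [key] at this
    exact_mod_cast this
  · intro h K
    induction K using SimpleGraph.ConnectedComponent.ind with
    | h u =>
      rw [key]
      exact_mod_cast h u

variable {H : SimpleGraph W} {L : W → Finset C}

/-- With `n = 2` there are no segments: two adjacent vertices of degree two would contribute at
least 4 + 2 to the sparsity sum, which must be below 3 · 2. So nothing needs to be deleted, and the
bound is 2(2 + 1) = 6. -/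
theorem IsSparse.hasClustering_six (hL : IsSparse H L) (hk : ∀ v, #(L v) ≤ 1) (φ : W → C) :
    HasClustering H φ 6 := by
  rw [hasClustering_iff]
  set M := monochromaticSubgraph H φ with hM
  have hle : M ≤ H := fun _ _ h => h.1
  have hcard : ∀ (s : Finset W) v, #{w ∈ s | M.Adj v w} ≤ #{w ∈ s | H.Adj v w} := fun s v =>
    card_le_card (monotone_filter_right s fun _ _ h => hle h)
  have hdeg : ∀ v, #{w | M.Adj v w} ≤ 2 := by
    intro v
    have h1 := hL.card_lt v
    have h2 := hk v
    have h3 := hcard univ v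
    omega
  obtain ⟨I, π, U, hU, hI, hcut⟩ := exists_cutting_segments M hdeg 2 le_rfl
  have hI0 : ∀ i ∈ I, ∃ v ∈ (∅ : Set W), v ∈ U ∧ π v = i := by
    intro i hi
    exfalso
    obtain ⟨h1, h2⟩ := hI i hi
    have h3 := hL {v ∈ U | π v = i} (card_pos.1 (by omega))
    rw [sum_add_distrib] at h3
    have h4 : #{v ∈ U | π v = i} • 2 ≤ ∑ v ∈ U with π v = i, #{w | H.Adj v w} :=
      card_nsmul_le_sum _ _ _ fun v hv => by
        rw [← hU v (mem_filter.1 hv).1]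
        exact hcard univ v
    have h5 : ∑ v ∈ U with π v = i, #{w ∈ {v ∈ U | π v = i} | M.Adj v w} ≤
        ∑ v ∈ U with π v = i, #{w ∈ {v ∈ U | π v = i} | H.Adj v w} :=
      sum_le_sum fun v _ => hcard _ v
    have h6 : ∑ v ∈ U with π v = i, #(L v) ≤ #{v ∈ U | π v = i} • 1 :=
      sum_le_card_nsmul _ _ _ fun v _ => hk v
    rw [h1] at h4 h6
    simp only [smul_eq_mul] at h4 h6
    omega
  intro u
  refine le_trans (card_le_card fun w hw => ?_) (hcut ∅ hI0 u (Set.notMem_empty u)).1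
  simp only [mem_filter, mem_univ, true_and] at hw ⊢
  exact hw.mono fun a b h => ⟨h, Set.notMem_empty a, Set.notMem_empty b⟩

/-- Conflict-free options, one from each segment of length `n` of the long monochromatic
components. -/
theorem IsMinColouring.exists_conflict_free [Fintype C] [Nonempty W] {φ : W → C} (hφ : IsMinColouring H L φ)
    (hL : IsSparse H L) {k : ℕ} (hk2 : 2 ≤ k) (hk : ∀ v, #(L v) ≤ k) {ι : Type*} (I : Finset ι)
    (π : W → ι) (U : Finset W) (hU : ∀ v ∈ U, colourDegree H φ v (φ v) = 2)
    (hI : ∀ i ∈ I, #{v ∈ U | π v = i} = 14 * k - 9 ∧ 2 * (14 * k - 9 - 1) ≤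
      ∑ v ∈ U with π v = i, #{w ∈ {v ∈ U | π v = i} | (monochromaticSubgraph H φ).Adj v w}) :
    ∃ f : ι → W × C, ∀ i ∈ I, ((f i).1 ∈ U ∧ π (f i).1 = i ∧ IsOption H L φ (f i).1 (f i).2) ∧
      ∀ j ∈ I, ¬ (conflictGraph H L φ).Adj (f i) (f j) := by
  obtain ⟨v₀⟩ := ‹Nonempty W›
  have : Nonempty (W × C) := ⟨(v₀, φ v₀)⟩
  obtain ⟨f, hf1, hf2⟩ := exists_isIndepTransversal (conflictGraph H L φ)
    {p : W × C | p.1 ∈ U ∧ IsOption H L φ p.1 p.2} (fun p => π p.1) (7 * k - 5) (by omega)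
    (hφ.card_conflicts_le hL hk) I (by
      intro i hi
      -- With n = 14k - 9, sparsity gives more than 2(n - 1) - n options in the segment, so at least
      -- n - 1 = 2(7k - 5), which is what Haxell's theorem requires.
      obtain ⟨h1, h2⟩ := hI i hi
      set S : Finset W := {v ∈ U | π v = i} with hS
      have h3 := hL S (card_pos.1 (by omega))
      rw [sum_add_distrib] at h3
      have h4 : ∑ v ∈ S, 3 * #(L v) ≤
          ∑ v ∈ S, (#{w | H.Adj v w} + #{b ∈ L v | IsOption H L φ v b} + 1) :=
        sum_le_sum fun v hv => hφ.card_le_card_options (hU v (mem_filter.1 hv).1)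
      rw [← mul_sum, sum_add_distrib, sum_add_distrib, sum_const, smul_eq_mul, mul_one] at h4
      have h5 : ∑ v ∈ S, #{w ∈ S | (monochromaticSubgraph H φ).Adj v w} ≤
          ∑ v ∈ S, #{w ∈ S | H.Adj v w} :=
        sum_le_sum fun v _ => card_le_card (monotone_filter_right S fun _ _ h => h.1)
      have h6 : ∑ v ∈ S, #{b ∈ L v | IsOption H L φ v b} ≤
          #(S.sigma fun v => {b ∈ L v | IsOption H L φ v b}) := (card_sigma _ _).ge
      have h7 : #(S.sigma fun v => {b ∈ L v | IsOption H L φ v b}) ≤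
          #{x ∈ ({p : W × C | p.1 ∈ U ∧ IsOption H L φ p.1 p.2} : Finset (W × C)) |
            π x.1 = i} := by
        refine card_le_card_of_injOn (fun x => (x.1, x.2)) (fun x hx => ?_) ?_
        · obtain ⟨h8, h9⟩ := mem_sigma.1 hx
          obtain ⟨h10, h11⟩ := mem_filter.1 h8
          simp only [coe_filter, mem_filter, mem_univ, true_and, Set.mem_ofPred_eq]
          exact ⟨⟨h10, (mem_filter.1 h9).2⟩, h11⟩
        · rintro ⟨a, b⟩ _ ⟨c, d⟩ _ h
          simp only [Prod.mk.injEq] at h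
          obtain ⟨rfl, rfl⟩ := h
          rfl
      omega)
  refine ⟨f, fun i hi => ⟨?_, hf2 i hi⟩⟩
  have h1 := (hf1 i hi).1
  simp only [mem_filter, mem_univ, true_and] at h1
  exact ⟨h1.1, (hf1 i hi).2, h1.2⟩

/-- Let n = 14k - 9. After recolouring, a component is either one piece of the cut graph, of at most
3n vertices, or lies in some `R v`: a recoloured `v` with the pieces at its two neighbours of the
new colour. Those neighbours have monochromatic degree at most one, so each piece has at most n +
n/2 vertices. As k ≥ 2, even 3n + 1 is within the bound. -/
theorem IsSparse.exists_colouring_of_fintype [Fintype C] (hL : IsSparse H L) {k : ℕ}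
    (hk2 : 2 ≤ k) (hk : ∀ v, #(L v) ≤ k) :
    ∃ φ : W → C, (∀ v, φ v ∈ L v) ∧ HasClustering H φ (57 * (k - 1) + 6) := by
  obtain ⟨φ, hφ⟩ := exists_isMinColouring H L hL.nonempty
  rcases isEmpty_or_nonempty W with hW | hW
  · exact ⟨φ, hφ.1, (hasClustering_iff H φ _).2 fun u => (hW.false u).elim⟩
  set M := monochromaticSubgraph H φ with hM
  have hMdeg : ∀ v, #{w | M.Adj v w} = colourDegree H φ v (φ v) :=
    card_monochromaticSubgraph_adj H φ
  obtain ⟨I, π, U, hU, hI, hcut⟩ := exists_cutting_segments M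
    (fun v => (hMdeg v).trans_le (hφ.colourDegree_le_two hL v)) (14 * k - 9) (by omega)
  obtain ⟨f, hf⟩ := hφ.exists_conflict_free hL hk2 hk I π U
    (fun v hv => (hMdeg v).symm.trans (hU v hv)) fun i hi => by convert hI i hi
  set X : Set W := {v | ∃ i ∈ I, (f i).1 = v} with hX
  set ψ : W → C := fun v => if h : v ∈ X then (f h.choose).2 else φ v with hψ
  have hψX : ∀ v ∈ X, ∃ i ∈ I, f i = (v, ψ v) := by
    intro v hv
    have h1 := hv.choose_spec
    refine ⟨hv.choose, h1.1, Prod.ext h1.2 ?_⟩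
    simp only [hψ, hv, dif_pos]
  have hψn : ∀ v ∉ X, ψ v = φ v := fun v hv => dif_neg hv
  have hopt : ∀ v ∈ X, IsOption H L φ v (ψ v) := by
    intro v hv
    obtain ⟨i, hi, hfi⟩ := hψX v hv
    have := (hf i hi).1.2.2
    rwa [hfi] at this
  have hconf : ∀ v ∈ X, ∀ w ∈ X, ¬ (conflictGraph H L φ).Adj (v, ψ v) (w, ψ w) := by
    intro v hv w hw
    obtain ⟨i, hi, hfi⟩ := hψX v hv
    obtain ⟨j, hj, hfj⟩ := hψX w hw
    rw [← hfi, ← hfj]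
    exact (hf i hi).2 j hj
  have hcut' := hcut X fun i hi => ⟨(f i).1, ⟨i, hi, rfl⟩, (hf i hi).1.1, (hf i hi).1.2.1⟩
  set K := cutAt M X with hK
  have hKX : ∀ a b, a ∉ X → K.Reachable a b → b ∉ X := by
    intro a b ha h
    rw [SimpleGraph.reachable_iff_reflTransGen] at h
    induction h with
    | refl => exact ha
    | tail _ hab _ => exact hab.2.2
  have hKM : K ≤ M := fun _ _ h => h.1
  set T : W → Finset W := fun v => {x | H.Adj v x ∧ φ x = ψ v} with hT
  have hmemT : ∀ v x, x ∈ T v ↔ H.Adj v x ∧ φ x = ψ v := fun v x => by simp [hT]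
  set piece : W → Finset W := fun x => {w | K.Reachable x w} with hpiece
  have hmemp : ∀ x w, w ∈ piece x ↔ K.Reachable x w := fun x w => by simp [hpiece]
  have hTone : ∀ v ∈ X, ∀ x ∈ T v, colourDegree H φ x (φ x) ≤ 1 := by
    intro v hv x hx
    obtain ⟨h1, h2⟩ := (hmemT v x).1 hx
    exact hφ.colourDegree_le_one hL (by rw [h2]; exact hopt v hv) h1.symm
  have hTX : ∀ v ∈ X, ∀ x ∈ T v, x ∉ X := by
    intro v hv x hx hxX
    have h1 := hTone v hv x hx
    have h2 := (hopt x hxX).2.2.1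
    omega
  set R : W → Finset W := fun v => insert v ((T v).biUnion piece) with hR
  have hRcard : ∀ v ∈ X, #(R v) ≤ 57 * (k - 1) + 6 := by
    intro v hv
    have h1 : #((T v).biUnion piece) ≤ #(T v) * (14 * k - 9 + (14 * k - 9) / 2) := by
      refine card_biUnion_le_card_mul _ _ _ fun x hx => ?_
      exact (hcut' x (hTX v hv x hx)).2 x (SimpleGraph.Reachable.refl _)
        ((hMdeg x).trans_le (hTone v hv x hx))
    have h2 : #(T v) = 2 := (hopt v hv).2.2.2
    have h3 := card_insert_le v ((T v).biUnion piece)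
    rw [h2] at h1
    simp only [hR]
    omega
  set M' := monochromaticSubgraph H ψ with hM'
  have hXX : ∀ a ∈ X, ∀ b ∈ X, ¬ M'.Adj a b := by
    intro a ha b hb hab
    refine hconf a ha b hb ⟨fun h => hab.1.ne (congrArg Prod.fst h), hab.2, hopt a ha, hopt b hb,
      Or.inl hab.1⟩
  have hnn : ∀ a ∉ X, ∀ b ∉ X, M'.Adj a b → K.Adj a b := by
    intro a ha b hb hab
    refine ⟨⟨hab.1, ?_⟩, ha, hb⟩
    have := hab.2
    rwa [hψn a ha, hψn b hb] at this
  have hXn : ∀ a ∈ X, ∀ b ∉ X, M'.Adj a b → b ∈ T a := by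
    intro a ha b hb hab
    refine (hmemT a b).2 ⟨hab.1, ?_⟩
    rw [← hψn b hb]
    exact hab.2.symm
  have hRclosed : ∀ v ∈ X, ∀ a ∈ R v, ∀ b, M'.Adj a b → b ∈ R v := by
    intro v hv a ha b hab
    rcases mem_insert.1 ha with rfl | ha
    · have hb : b ∉ X := fun hb => hXX a hv b hb hab
      exact mem_insert_of_mem (mem_biUnion.2 ⟨b, hXn a hv b hb hab, (hmemp b b).2
        (SimpleGraph.Reachable.refl _)⟩)
    · obtain ⟨x, hx, hxa⟩ := mem_biUnion.1 ha
      have hxa' := (hmemp x a).1 hxa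
      -- A second recoloured vertex attached to this piece would conflict with `v`, since both would
      -- touch the same monochromatic component of `φ`.
      have haX := hKX x a (hTX v hv x hx) hxa'
      by_cases hb : b ∈ X
      · obtain ⟨h1, h2⟩ := (hmemT b a).1 (hXn b hb a haX hab.symm)
        obtain ⟨h3, h4⟩ := (hmemT v x).1 hx
        have h5 : M.Reachable x a := hxa'.mono hKM
        have h6 : φ x = φ a := eq_of_reachable_monochromaticSubgraph h5
        by_cases hbv : b = v
        · exact mem_insert.2 (Or.inl hbv)
        · exact absurd ⟨fun h => hbv (congrArg Prod.fst h).symm, by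
            show ψ v = ψ b
            rw [← h4, ← h2, h6], hopt v hv, hopt b hb, Or.inr ⟨x, a, h3, h4, h1, h2, h5⟩⟩
            (hconf v hv b hb)
      · exact mem_insert_of_mem (mem_biUnion.2 ⟨x, hx, (hmemp x b).2
          (hxa'.trans (hnn a haX b hb hab).reachable)⟩)
  refine ⟨ψ, fun v => ?_, (hasClustering_iff H ψ _).2 fun u => ?_⟩
  · by_cases hv : v ∈ X
    · exact (hopt v hv).1
    · rw [hψn v hv]
      exact hφ.1 v
  · by_cases hu : u ∈ X
    · exact (card_reachable_le M' (R u) (mem_insert_self _ _) (hRclosed u hu)).trans (hRcard u hu)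
    by_cases hatt : ∃ v ∈ X, ∃ a ∈ T v, K.Reachable u a
    · obtain ⟨v, hv, a, ha, hua⟩ := hatt
      exact (card_reachable_le M' (R v) (mem_insert_of_mem (mem_biUnion.2 ⟨a, ha,
        (hmemp a u).2 hua.symm⟩)) (hRclosed v hv)).trans (hRcard v hv)
    · have h1 := (hcut' u hu).1
      refine (card_reachable_le M' (piece u) ((hmemp u u).2 (SimpleGraph.Reachable.refl _))
        fun a ha b hab => ?_).trans (h1.trans (by omega))
      have ha' := (hmemp u a).1 ha
      have haX := hKX u a hu ha'
      have hb : b ∉ X := fun hb => hatt ⟨b, hb, a, hXn b hb a haX hab.symm, ha'⟩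
      exact (hmemp u b).2 (ha'.trans (hnn a haX b hb hab).reachable)

/-- Restricting to the finitely many colours in the lists makes the set of vertex-colour pairs
finite, as the transversal argument needs. -/
theorem IsSparse.exists_colouring (hL : IsSparse H L) {k : ℕ} (hk1 : 1 ≤ k)
    (hk : ∀ v, #(L v) ≤ k) :
    ∃ φ : W → C, (∀ v, φ v ∈ L v) ∧ HasClustering H φ (57 * (k - 1) + 6) := by
  rcases Nat.lt_or_ge k 2 with hk2 | hk2
  · obtain rfl : k = 1 := by omega
    choose φ hφ using hL.nonempty
    exact ⟨φ, hφ, hL.hasClustering_six hk φ⟩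
  · set P : Finset C := univ.biUnion L with hP
    have hcard : ∀ v, #((L v).subtype (· ∈ P)) = #(L v) := by
      intro v
      rw [card_subtype, filter_true_of_mem]
      exact fun c hc => mem_biUnion.2 ⟨v, mem_univ v, hc⟩
    have hL' : IsSparse H fun v => (L v).subtype (· ∈ P) := by
      intro S hS
      simp only [hcard]
      exact hL S hS
    obtain ⟨φ, hφ, hcl⟩ := hL'.exists_colouring_of_fintype hk2 fun v => (hcard v).trans_le (hk v)
    exact ⟨Subtype.val ∘ φ, fun v => mem_subtype.1 (hφ v),
      hcl.comp_injective Subtype.val_injective⟩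

end Clustering

/-! ### From maximum average degree to sparse list assignments. -/

theorem card_filter_comap_adj {V : Type*} (G : SimpleGraph V) (p : V → Prop)
    (H : SimpleGraph {v // p v}) (hH : ∀ a b, H.Adj a b ↔ G.Adj a b) (S : Finset {v // p v})
    (v : {v // p v}) :
    #{w ∈ S | H.Adj v w} = #{w ∈ S.map (Function.Embedding.subtype p) | G.Adj v w} := by
  rw [filter_map, card_map]
  congr 1
  ext w
  simp only [mem_filter]
  exact and_congr_right fun _ => hH v w

theorem card_reachable_map_le {V V' : Type*} [Fintype V] [Fintype V'] (M' : SimpleGraph V')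
    (M : SimpleGraph V) (e : V' ↪ V) (u : V')
    (h : ∀ a b, M.Adj (e a) b → ∃ b', e b' = b ∧ M'.Adj a b') :
    #{w | M.Reachable (e u) w} ≤ #{w | M'.Reachable u w} := by
  rw [← card_map e]
  refine card_reachable_le M _ (mem_map_of_mem e (by simp)) fun a ha b hab => ?_
  obtain ⟨a, ha', rfl⟩ := mem_map.1 ha
  obtain ⟨b, rfl, hab'⟩ := h a b hab
  exact mem_map_of_mem e (mem_filter.2 ⟨mem_univ _,
    (mem_filter.1 ha').2.trans hab'.reachable⟩)

theorem average_lt_of_mad_lt {V : Type*} [Fintype V] (G : SimpleGraph V) {k : ℕ}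
    (hk : 2 / 3 * mad G < k) (U : Finset V) (hU : U.Nonempty) :
    2 * ∑ v ∈ U, #{w ∈ U | G.Adj v w} < 3 * k * #U := by
  set K : G.Subgraph := (⊤ : G.Subgraph).induce U with hK
  have h1 : averageDegree K.coe ≤ mad G := (isGreatest_mad G).2 ⟨K, by congr⟩
  have hdeg : ∀ v : K.verts, K.coe.degree v = #{w ∈ U | G.Adj v w} := by
    intro v
    rw [← SimpleGraph.card_neighborFinset_eq_degree,
      ← card_map (Function.Embedding.subtype (· ∈ K.verts))]
    congr 1
    ext w
    simp only [mem_map, SimpleGraph.mem_neighborFinset, Function.Embedding.subtype_apply,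
      mem_filter]
    constructor
    · rintro ⟨x, hx, rfl⟩
      exact ⟨x.2, hx.2.2⟩
    · rintro ⟨hw, hvw⟩
      exact ⟨⟨w, hw⟩, ⟨v.2, hw, hvw⟩, rfl⟩
  let e : K.verts ≃ {v // v ∈ U} := Equiv.subtypeEquivRight fun _ => Iff.rfl
  have h2 : averageDegree K.coe = ((∑ v ∈ U, #{w ∈ U | G.Adj v w} : ℕ) : ℝ) / #U := by
    rw [averageDegree]
    congr 1
    · rw [← sum_coe_sort U, Nat.cast_sum]
      exact Fintype.sum_equiv e _ _ fun v =>
        congrArg Nat.cast ((by congr; exact Subsingleton.elim _ _ : _ = K.coe.degree v).trans (hdeg v))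
    · rw [← Fintype.card_coe U]
      exact congrArg Nat.cast (Fintype.card_congr e)
  have hpos : (0 : ℝ) < #U := by exact_mod_cast hU.card_pos
  rw [h2, div_le_iff₀ hpos] at h1
  have h3 : (2 : ℝ) * (∑ v ∈ U, #{w ∈ U | G.Adj v w} : ℕ) < 3 * k * #U := by nlinarith
  exact_mod_cast h3

/-- Density is removed first: a largest dense set `B` is coloured by induction, and the lists
outside shrink by at most one colour per neighbour in `B`, a loss that the maximality of `B` pays
for. -/
theorem exists_colouring_of_average_lt {C : Type*} {k : ℕ} (hk1 : 1 ≤ k) (n : ℕ) :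
    ∀ (V : Type u) [Fintype V] (G : SimpleGraph V) (L : V → Finset C), Fintype.card V = n →
      (∀ v, #(L v) = k) →
      (∀ U : Finset V, U.Nonempty → 2 * ∑ v ∈ U, #{w ∈ U | G.Adj v w} < 3 * k * #U) →
      ∃ φ : V → C, (∀ v, φ v ∈ L v) ∧ HasClustering G φ (57 * (k - 1) + 6) := by
  induction n using Nat.strong_induction_on with
  | _ n ih =>
    intro V _ G L hn hL hG
    rcases isEmpty_or_nonempty V with hV | hV
    · exact ⟨fun v => (hV.false v).elim, fun v => (hV.false v).elim,
        (hasClustering_iff G _ _).2 fun v => (hV.false v).elim⟩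
    obtain ⟨B, hB, hmax⟩ := exists_max_image
      ({B | 3 * k * #B ≤ ∑ v ∈ B, (#{w | G.Adj v w} + #{w ∈ B | G.Adj v w})} : Finset (Finset V))
      card ⟨∅, by simp⟩
    simp only [mem_filter, mem_univ, true_and] at hB hmax
    have hBuniv : B ≠ univ := by
      rintro rfl
      have := hG univ univ_nonempty
      rw [sum_add_distrib] at hB
      omega
    have hBlt : #B < n := by
      rw [← hn]
      exact card_lt_card (ssubset_univ_iff.2 hBuniv)
    obtain ⟨HA, hHA⟩ : ∃ HA : SimpleGraph {v // v ∉ B}, ∀ a b, HA.Adj a b ↔ G.Adj a b :=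
      ⟨G.comap Subtype.val, fun _ _ => Iff.rfl⟩
    obtain ⟨HB, hHB⟩ : ∃ HB : SimpleGraph {v // v ∈ B}, ∀ a b, HB.Adj a b ↔ G.Adj a b :=
      ⟨G.comap Subtype.val, fun _ _ => Iff.rfl⟩
    obtain ⟨φB, hφB, hclB⟩ := ih #B hBlt {v // v ∈ B} HB (fun v => L v)
      (by simp) (fun v => hL v) fun U hU => by
        have h1 := hG (U.map (Function.Embedding.subtype _)) (hU.map)
        rw [sum_map, card_map] at h1
        rwa [sum_congr rfl fun v _ => card_filter_comap_adj G (· ∈ B) HB hHB U v]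
    set forb : V → Finset C := fun v =>
      ({w : {v // v ∈ B} | G.Adj v w} : Finset {v // v ∈ B}).image φB with hforb
    have hforbcard : ∀ v, #(forb v) ≤ #{w ∈ B | G.Adj v w} := by
      intro v
      refine card_image_le.trans (card_le_card_of_injOn Subtype.val (fun w hw => ?_)
        Subtype.val_injective.injOn)
      simp only [coe_filter, mem_univ, true_and, Set.mem_ofPred_eq] at hw ⊢
      exact ⟨w.2, hw⟩
    have hsparse : IsSparse HA fun v => L v \ forb v := by
      intro S' hS'
      set S : Finset V := S'.map (Function.Embedding.subtype _) with hS
      have hdisj : Disjoint B S := by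
        refine disjoint_left.2 fun v hv hvS => ?_
        obtain ⟨w, -, rfl⟩ := mem_map.1 hvS
        exact w.2 hv
      have hSpos : 0 < #S := by
        rw [hS, card_map]
        exact hS'.card_pos
      -- In the sum for `B ∪ S` an edge between `B` and `S` counts three times beyond the sums for
      -- `B` and for `S` in `G - B`: once at its end in `B`, twice at its end in `S`. This matches
      -- three times the one colour it may delete from a list.
      have h1 : ¬ 3 * k * #(B ∪ S) ≤
          ∑ v ∈ B ∪ S, (#{w | G.Adj v w} + #{w ∈ B ∪ S | G.Adj v w}) := by
        intro h
        have := hmax _ h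
        rw [card_union_of_disjoint hdisj] at this
        omega
      have hsplit : ∀ v, #{w ∈ B ∪ S | G.Adj v w} =
          #{w ∈ B | G.Adj v w} + #{w ∈ S | G.Adj v w} := by
        intro v
        rw [filter_union, card_union_of_disjoint (disjoint_filter_filter hdisj)]
      have huniv : (univ : Finset {v // v ∉ B}).map (Function.Embedding.subtype _) = Bᶜ := by
        ext v
        simp
      have hdeg : ∀ v, #{w | G.Adj v w} = #{w ∈ B | G.Adj v w} + #{w ∈ Bᶜ | G.Adj v w} := by
        intro v
        rw [← card_union_of_disjoint (disjoint_filter_filter disjoint_compl_right),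
          ← filter_union, union_compl]
      have hdouble : ∑ v ∈ B, #{w ∈ S | G.Adj v w} = ∑ v ∈ S, #{w ∈ B | G.Adj v w} := by
        simp only [card_filter]
        rw [sum_comm]
        simp only [G.adj_comm]
      rw [card_union_of_disjoint hdisj, sum_union hdisj] at h1
      simp only [hsplit] at h1
      have h2 : ∑ v ∈ S', (#{w | HA.Adj v w} +
          #{w ∈ S' | HA.Adj v w}) =
          ∑ v ∈ S, (#{w ∈ Bᶜ | G.Adj v w} + #{w ∈ S | G.Adj v w}) := by
        rw [hS, sum_map]
        refine sum_congr rfl fun v _ => ?_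
        rw [card_filter_comap_adj G (· ∉ B) HA hHA,
          card_filter_comap_adj G (· ∉ B) HA hHA, huniv]
        rfl
      have h3 : #S * k ≤ ∑ v ∈ S', #(L v \ forb v) + ∑ v ∈ S, #{w ∈ B | G.Adj v w} := by
        rw [hS, sum_map, ← sum_add_distrib, ← smul_eq_mul, card_map]
        refine card_nsmul_le_sum _ _ _ fun v _ => ?_
        have h4 := le_card_sdiff (forb v) (L v)
        rw [hL] at h4
        exact (show k ≤ #(L v \ forb v) + #(forb v) by omega).trans
          (Nat.add_le_add_left (hforbcard v) _)
      simp only [hdeg, sum_add_distrib] at h1 h2 hB ⊢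
      rw [mul_add] at h1
      rw [h2]
      have h4 : 3 * k * #S = 3 * (#S * k) := by ring
      omega
    obtain ⟨φA, hφA, hclA⟩ := hsparse.exists_colouring hk1 fun v =>
      (card_le_card sdiff_subset).trans (hL v).le
    set φ : V → C := fun v => if h : v ∈ B then φB ⟨v, h⟩ else φA ⟨v, h⟩ with hφ
    have hφ1 : ∀ v : {v // v ∈ B}, φ v = φB v := fun v => dif_pos v.2
    have hφ2 : ∀ v : {v // v ∉ B}, φ v = φA v := fun v => dif_neg v.2
    have hcross : ∀ (v : {v // v ∉ B}) (w : {v // v ∈ B}), G.Adj v w → φ v ≠ φ w := by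
      intro v w h heq
      rw [hφ1, hφ2] at heq
      exact (mem_sdiff.1 (hφA v)).2 (mem_image.2 ⟨w, by simpa using h, heq.symm⟩)
    rw [hasClustering_iff] at hclA hclB
    refine ⟨φ, fun v => ?_, (hasClustering_iff G φ _).2 fun u => ?_⟩
    · by_cases hv : v ∈ B
      · rw [hφ1 ⟨v, hv⟩]
        exact hφB ⟨v, hv⟩
      · rw [hφ2 ⟨v, hv⟩]
        exact (mem_sdiff.1 (hφA ⟨v, hv⟩)).1
    · by_cases hu : u ∈ B
      · refine (card_reachable_map_le (monochromaticSubgraph HB φB) _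
          (Function.Embedding.subtype _) ⟨u, hu⟩ fun a b hab => ?_).trans (hclB ⟨u, hu⟩)
        have hb : b ∈ B := by
          by_contra hb
          exact hcross ⟨b, hb⟩ a hab.1.symm hab.2.symm
        refine ⟨⟨b, hb⟩, rfl, (hHB _ _).2 hab.1, ?_⟩
        rw [← hφ1, ← hφ1]
        exact hab.2
      · refine (card_reachable_map_le (monochromaticSubgraph HA φA) _
          (Function.Embedding.subtype _) ⟨u, hu⟩ fun a b hab => ?_).trans (hclA ⟨u, hu⟩)
        have hb : b ∉ B := fun hb => hcross a ⟨b, hb⟩ hab.1 hab.2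
        refine ⟨⟨b, hb⟩, rfl, (hHA _ _).2 hab.1, ?_⟩
        rw [← hφ2, ← hφ2]
        exact hab.2

theorem choosableWithClustering_of_mad_lt {V : Type u} [Fintype V] (G : SimpleGraph V) {k : ℕ}
    (hk1 : 1 ≤ k) (hk : 2 / 3 * mad G < k) :
    ChoosableWithClustering.{u, w} G k (57 * (k - 1) + 6) := by
  intro C L hL
  have h1 : ∀ v, ∃ s : Finset C, ↑s ⊆ L v ∧ #s = k := by
    intro v
    obtain ⟨t, ht, htk⟩ := Set.exists_subset_encard_eq (hL v)
    have hfin : t.Finite := Set.finite_of_encard_eq_coe htk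
    refine ⟨hfin.toFinset, by simpa using ht, ?_⟩
    rw [hfin.encard_eq_coe_toFinset_card] at htk
    exact_mod_cast htk
  choose L' hL' hcard using h1
  obtain ⟨φ, hφ, hcl⟩ := exists_colouring_of_average_lt hk1 _ V G L' rfl hcard
    (average_lt_of_mad_lt G hk)
  exact ⟨φ, fun v => hL' v (hφ v), hcl⟩

end ClusteredColouring

/-! ### The two conclusions. -/

theorem mainTheorem5 :
    (∀ (V : Type u) [Fintype V] (G : SimpleGraph V),
      ClusteredColouring.ChoosableWithClustering.{u, w} G
        ⌊(2 / 3 : ℝ) * ClusteredColouring.mad G + 1⌋₊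
        (57 * ⌊(2 / 3 : ℝ) * ClusteredColouring.mad G⌋₊ + 6)) ∧
    (∀ m : ℝ, 0 ≤ m →
      ClusteredColouring.clusteredChromaticNumber.{u}
          (fun (V : Type u) [Fintype V] (G : SimpleGraph V) => ClusteredColouring.mad G ≤ m) ≤
        ((⌊(2 / 3 : ℝ) * m⌋₊ + 1 : ℕ) : ℕ∞)) := by
  constructor
  · intro V _ G
    have h0 : 0 ≤ ClusteredColouring.mad G := by
      obtain ⟨K, hK⟩ := (ClusteredColouring.isGreatest_mad G).1
      rw [← hK]
      exact div_nonneg (Finset.sum_nonneg fun _ _ => Nat.cast_nonneg _) (Nat.cast_nonneg _)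
    rw [Nat.floor_add_one (by positivity)]
    have := ClusteredColouring.choosableWithClustering_of_mad_lt.{u, w} G
      (k := ⌊(2 / 3 : ℝ) * ClusteredColouring.mad G⌋₊ + 1) (by omega)
      (by exact_mod_cast Nat.lt_floor_add_one _)
    simpa using this
  · intro m _
    refine sInf_le ⟨_, rfl, 57 * ⌊(2 / 3 : ℝ) * m⌋₊ + 6, fun V _ G hG => ?_⟩
    -- The number of colours is taken from `m` rather than from `mad G`, so that one clustering
    -- bound serves the whole class.
    have h1 : (2 / 3 : ℝ) * ClusteredColouring.mad G < (⌊(2 / 3 : ℝ) * m⌋₊ + 1 : ℕ) := by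
      have := Nat.lt_floor_add_one ((2 / 3 : ℝ) * m)
      push_cast
      linarith
    obtain ⟨φ, -, hφ⟩ := ClusteredColouring.choosableWithClustering_of_mad_lt.{u, 0} G
      (by omega) h1 (Fin (⌊(2 / 3 : ℝ) * m⌋₊ + 1)) (fun _ => Set.univ) fun _ => by simp
    exact ⟨φ, by simpa using hφ⟩
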